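/- Let $K=(K,\prec)$ be an abstract elementary class with Löwenheim–Skolem number $\mathrm{LS}(K)$, the least infinite cardinal $\mu\ge|\tau(K)|$ such that every subset $A$ of every $M\in K$ lies in some $N\prec M$ with $|N|\le|A|+\mu$. For a class $\mathcal F$ of cardinals, $K_{\mathcal F}$ is the class of $M\in K$ with $|M|\in\mathcal F$, and $M$ is an *$\mathcal F$-amalgamation base* if $M\in K_{\mathcal F}$ and for any two $K$-embeddings $f_\ell:M\to M_\ell$ with $M_\ell\in K_{\mathcal F}$ ($\ell=1,2$) there are $N\in K$ and $K$-embeddings $g_\ell:M_\ell\to N$ with $g_1f_1=g_2f_2$. We write $\mu$ for $\mathcal F=\{\mu\}$, $<\kappa$ for $\mathcal F=[\mathrm{LS}(K),\kappa)$ and $\le\lambda$ for $\mathcal F=[\mathrm{LS}(K),\lambda]$. Let $\kappa$ be a cardinal with $\mathrm{LS}(K)<\kappa$. 1. Suppose $\kappa$ is weakly compact, i.e. strongly inaccessible and such that every set of at most $\kappa$ sentences of $\mathbb L_{\kappa,\kappa}$ all of whose subsets of size $<\kappa$ are satisfiable is satisfiable. If $M\in K_\kappa$ is the union $\bigcup_{i<\kappa}M_i$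 of a $\prec$-increasing chain (not necessarily continuous) of $<\kappa$-amalgamation bases $M_i$, then $M$ is a $\kappa$-amalgamation base. 2. Suppose $\kappa$ is measurable, i.e. uncountable and carrying a $\kappa$-additive $\{0,1\}$-valued measure, defined on all subsets of $\kappa$, that vanishes on points and gives $\kappa$ measure $1$. If $M\in K$ is the union $\bigcup_{i<\kappa}M_i$ of a $\prec$-increasing chain in which each $M_i$ is a $\lambda_i$-amalgamation base, then $M$ is a $(\sup_{i<\kappa}\lambda_i)$-amalgamation base. 3. Let $\lambda\ge\kappa$ and suppose $\kappa$ is $\lambda$-strongly compact, i.e. there is a $\kappa$-complete fine ultrafilter on $P_\kappa\lambda=\{x\subseteq\lambda:|x|<\kappa\}$. If $M\in K$, $|M|\le\lambda$, and $M=\bigcup_{x\in P_\kappa\lambda}M_x$ where each $M_x$ is a $<\kappa$-amalgamation base and $M_x\prec M_y$ whenever $x\subseteq y$, then $M$ is a $\le\lambda$-amalgamation base. -/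

import Mathlib

open FirstOrder Cardinal Set

universe u

namespace AECLC

/-! ### Abstract elementary classes -/

/-- A class `K` of `L`-structures together with a relation `≺` of strong substructure.
`Mem M` says `M ∈ K`; for a substructure `S` of `N`, `Strong S` says `S ≺ N`. -/
structure StrongClass (L : FirstOrder.Language.{u, u}) where
  Mem : ∀ (M : Type u) [L.Structure M], Prop
  Strong : ∀ {N : Type u} [L.Structure N], L.Substructure N → Prop

namespace StrongClass

variable {L : FirstOrder.Language.{u, u}} (K : StrongClass L)

/-- A `K`-embedding: an embedding whose range is a strong substructure of its target. -/
def IsEmb {M N : Type u} [L.Structure M] [L.Structure N] (f : M ↪[L] N) : Prop :=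
  K.Strong f.toHom.range

/-- `S ≺ T`, for two substructures `S`, `T` of one structure. -/
def StrongLE {N : Type u} [L.Structure N] (S T : L.Substructure N) : Prop :=
  ∃ h : S ≤ T, K.IsEmb (FirstOrder.Language.Substructure.inclusion h)

/-- `μ` is an infinite cardinal, at least the size of the vocabulary, such that each subset `A` of
each `M ∈ K` lies in some `S ≺ M` with `|S| ≤ |A| + μ`. -/
def IsLSBound (μ : Cardinal.{u}) : Prop :=
  ℵ₀ ≤ μ ∧ L.card ≤ μ ∧
    ∀ (M : Type u) [L.Structure M], K.Mem M → ∀ A : Set M,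
      ∃ S : L.Substructure M, K.Strong S ∧ A ⊆ (S : Set M) ∧ #S ≤ #A + μ

end StrongClass

/-- At limit indices the member of the family is the union of the earlier members. -/
def IsContinuousFamily {L : FirstOrder.Language.{u, u}} {N : Type u} [L.Structure N]
    {I : Type u} [LinearOrder I] (M : I → L.Substructure N) : Prop :=
  ∀ i, Order.IsSuccLimit i → (M i : Set N) = ⋃ j ∈ Iio i, (M j : Set N)

/-- Abstract elementary classes in the vocabulary `L`. -/
structure AEC (L : FirstOrder.Language.{u, u}) extends StrongClass L where
  /-- `≺` relates members of `K`. -/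
  mem_of_strong : ∀ {N : Type u} [L.Structure N] (S : L.Substructure N), Strong S → Mem S ∧ Mem N
  /-- `K` is closed under isomorphism. -/
  mem_of_iso : ∀ {M N : Type u} [L.Structure M] [L.Structure N] (_ : M ≃[L] N), Mem M → Mem N
  /-- `≺` is closed under isomorphism. -/
  strong_of_iso : ∀ {M N : Type u} [L.Structure M] [L.Structure N] (e : M ≃[L] N)
    (S : L.Substructure M), Strong S → Strong (S.map e.toHom)
  /-- `≺` is reflexive on `K`. -/
  strong_refl : ∀ (N : Type u) [L.Structure N], Mem N → Strong (⊤ : L.Substructure N)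
  /-- `≺` is transitive. -/
  strong_trans : ∀ {N : Type u} [L.Structure N] (S T : L.Substructure N),
    toStrongClass.StrongLE S T → Strong T → Strong S
  /-- Coherence: if `S ⊆ T`, `S ≺ N` and `T ≺ N`, then `S ≺ T`. -/
  coherence : ∀ {N : Type u} [L.Structure N] (S T : L.Substructure N),
    S ≤ T → Strong S → Strong T → toStrongClass.StrongLE S T
  /-- The union `N` of a continuous `≺`-increasing chain lies in `K`, and each member of the chain
  is strong in it. -/
  chain_union : ∀ {N : Type u} [L.Structure N] (I : Type u) [LinearOrder I] [WellFoundedLT I]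
    [Nonempty I] (M : I → L.Substructure N),
    (∀ i j, i ≤ j → toStrongClass.StrongLE (M i) (M j)) → IsContinuousFamily M →
    (⋃ i, (M i : Set N)) = Set.univ → Mem N ∧ ∀ i, Strong (M i)
  /-- Smoothness: the union of a continuous increasing chain of strong substructures of `P` is a
  strong substructure of `P`. -/
  chain_smooth : ∀ {P : Type u} [L.Structure P] (I : Type u) [LinearOrder I] [WellFoundedLT I]
    [Nonempty I] (M : I → L.Substructure P),
    (∀ i j, i ≤ j → toStrongClass.StrongLE (M i) (M j)) → IsContinuousFamily M →
    (∀ i, Strong (M i)) → ∀ S : L.Substructure P, (S : Set P) = (⋃ i, (M i : Set P)) → Strong S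
  /-- There is a Löwenheim–Skolem cardinal. -/
  exists_LS : ∃ μ, toStrongClass.IsLSBound μ

namespace AEC

variable {L : FirstOrder.Language.{u, u}} (K : AEC L)

/-- The Löwenheim–Skolem number `LS(K)`. -/
noncomputable def LS : Cardinal.{u} := sInf {μ | K.IsLSBound μ}

/-- `M` is an `F`-amalgamation base: `M ∈ K` has size in `F`, and any two `K`-extensions of `M`
with sizes in `F` can be amalgamated over `M`. -/
def IsAmalgamationBase (F : Set Cardinal.{u}) (M : Type u) [L.Structure M] : Prop :=
  K.Mem M ∧ #M ∈ F ∧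
    ∀ (M₁ M₂ : Type u) [L.Structure M₁] [L.Structure M₂] (f₁ : M ↪[L] M₁) (f₂ : M ↪[L] M₂),
      #M₁ ∈ F → #M₂ ∈ F → K.IsEmb f₁ → K.IsEmb f₂ →
      ∃ (N : Type u) (_ : L.Structure N) (g₁ : M₁ ↪[L] N) (g₂ : M₂ ↪[L] N),
        K.IsEmb g₁ ∧ K.IsEmb g₂ ∧ ∀ m : M, g₁ (f₁ m) = g₂ (f₂ m)

/-- `M` is the `≺`-directed union of the family `Ms` of its substructures, over the partial
order `I`. -/
def IsUnionOf {M : Type u} [L.Structure M] {I : Type u} [PartialOrder I]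
    (Ms : I → L.Substructure M) : Prop :=
  (∀ i j, i ≤ j → K.StrongLE (Ms i) (Ms j)) ∧ (⋃ i, (Ms i : Set M)) = Set.univ

end AEC

/-! ### The infinitary logics `L_{κ,κ}` -/

/-- Formulas of `L_{κ,κ}` with free variables indexed by `α`: conjunctions of fewer than `κ`
formulas and universal quantification over fewer than `κ` variables at once are allowed. -/
inductive InfFormula (L : FirstOrder.Language.{u, u}) (κ : Cardinal.{u}) : Type u → Type (u + 1)
  | equal {α : Type u} (t₁ t₂ : L.Term α) : InfFormula L κ α
  | rel {α : Type u} {n : ℕ} (R : L.Relations n) (ts : Fin n → L.Term α) : InfFormula L κ α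
  | neg {α : Type u} (φ : InfFormula L κ α) : InfFormula L κ α
  | conj {α : Type u} (I : Type u) (hI : #I < κ) (φ : I → InfFormula L κ α) : InfFormula L κ α
  | all {α : Type u} (β : Type u) (hβ : #β < κ) (φ : InfFormula L κ (α ⊕ β)) : InfFormula L κ α

/-- Satisfaction of an `L_{κ,κ}`-formula under an assignment. -/
def InfFormula.Realize {L : FirstOrder.Language.{u, u}} {κ : Cardinal.{u}} (M : Type u) [L.Structure M] :
    ∀ {α : Type u}, InfFormula L κ α → (α → M) → Prop
  | _, .equal t₁ t₂, v => t₁.realize v = t₂.realize v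
  | _, .rel R ts, v => FirstOrder.Language.Structure.RelMap R fun i => (ts i).realize v
  | _, .neg φ, v => ¬ φ.Realize M v
  | _, .conj _ _ φ, v => ∀ i, (φ i).Realize M v
  | _, .all β _ φ, v => ∀ w : β → M, φ.Realize M (Sum.elim v w)

/-- Sentences of `L_{κ,κ}`. -/
abbrev InfSentence (L : FirstOrder.Language.{u, u}) (κ : Cardinal.{u}) : Type (u + 1) :=
  InfFormula L κ PEmpty.{u + 1}

/-- A set of `L_{κ,κ}`-sentences has a (non-empty) model. -/
def InfSatisfiable {L : FirstOrder.Language.{u, u}} {κ : Cardinal.{u}} (T : Set (InfSentence L κ)) : Prop :=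
  ∃ (M : Type u) (_ : L.Structure M), Nonempty M ∧ ∀ φ ∈ T, φ.Realize M PEmpty.elim

/-! ### Large cardinals -/

/-- `κ` is weakly compact: it is strongly inaccessible, and every set of at most `κ` sentences of
`L_{κ,κ}`, each of whose subsets of size `< κ` is satisfiable, is satisfiable. -/
def IsWeaklyCompact (κ : Cardinal.{u}) : Prop :=
  κ.IsInaccessible ∧
    ∀ (L : FirstOrder.Language.{u, u}) (T : Set (InfSentence L κ)), #T ≤ Cardinal.lift.{u + 1} κ →
      (∀ T₀ ⊆ T, #T₀ < Cardinal.lift.{u + 1} κ → InfSatisfiable T₀) → InfSatisfiable T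

/-- `κ` is measurable: it is uncountable, and there is a `κ`-additive, `{0,1}`-valued measure,
defined on all subsets of `κ`, that gives measure `1` to `κ` and `0` to every point. -/
def IsMeasurable (κ : Cardinal.{u}) : Prop :=
  ℵ₀ < κ ∧ ∃ m : Set κ.ord.ToType → ENNReal,
    (∀ A, m A = 0 ∨ m A = 1) ∧ m Set.univ = 1 ∧ (∀ a, m {a} = 0) ∧
    ∀ 𝒜 : Set (Set κ.ord.ToType), #𝒜 < κ → 𝒜.PairwiseDisjoint id → m (⋃₀ 𝒜) = ∑' A : 𝒜, m A

/-- `P_κ λ`, the set of subsets of `λ` of size less than `κ`, ordered by inclusion. -/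
abbrev Pk (κ lam : Cardinal.{u}) : Type u := {x : Set lam.ord.ToType // #x < κ}

/-- `κ` is `(δ, λ)`-strongly compact: `δ ≤ κ ≤ λ` and there is a `δ`-complete fine ultrafilter
on `P_κ λ`. -/
def IsStronglyCompactBetween (δ κ lam : Cardinal.{u}) : Prop :=
  δ ≤ κ ∧ κ ≤ lam ∧ ∃ U : Ultrafilter (Pk κ lam),
    (∀ 𝒮 : Set (Set (Pk κ lam)), #𝒮 < δ → (∀ A ∈ 𝒮, A ∈ U) → ⋂₀ 𝒮 ∈ U) ∧
    ∀ a : lam.ord.ToType, {x : Pk κ lam | a ∈ x.1} ∈ U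

/-- `κ` is `λ`-strongly compact. -/
def IsStronglyCompactUpTo (κ lam : Cardinal.{u}) : Prop := IsStronglyCompactBetween κ κ lam

end AECLC

/-! All three parts follow one pattern, an ultraproduct argument in which only small pieces of the
ultraproduct are used. Given extensions `M₁`, `M₂` of `M`, take for each index `i` strong submodels
`A₁ i`, `A₂ i` containing the images of `Ms i`, small enough for `Ms i` to amalgamate them in some
`P i`. These approximations converge along a filter on the index set (`exists_amalgam_of_bases`).

The amalgam of `M₁` and `M₂` is a direct limit. To each finite `e ⊆ M₁ ⊕ M₂` attach a set `σ e` of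
at most `LS(K)` sections of `∏ P i` whose values at every `i` form a strong submodel of `P i`. If
indices `ix e` are chosen so that the first-order type of `σ e` at `ix e` persists at `ix e'` for `e
≤ e'`, then `f (ix e) ↦ f (ix e')` is a `K`-embedding, the limit lies in `K` (`exists_limit`), and
`M₁`, `M₂` map into it (`exists_isEmb_limit`, `exists_amalgam`).

Choosing the indices needs only `IsCompactFilter`: closure under `LS(K)` intersections, and one
decision about sets of indices that is locally realized by points. A `κ`-complete ultrafilter
decides by membership. For weakly compact `κ` the tail filter suffices, because the decision is a
model of a propositional `L_{κ,κ}`-theory with at most `κ` sentences. -/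

open FirstOrder.Language

universe v

namespace AECLC
namespace AEC

variable {L : FirstOrder.Language.{u, u}} (K : AEC L)

/-! ### Calculus of `K`-embeddings and strong substructures. -/

section Embeddings

variable {M N P : Type u} [L.Structure M] [L.Structure N] [L.Structure P]

theorem mem_target_of_isEmb {f : M ↪[L] N} (hf : K.IsEmb f) : K.Mem N :=
  (K.mem_of_strong _ hf).2

theorem isEmb_subtype_iff (S : L.Substructure N) : K.IsEmb S.subtype ↔ K.Strong S := by
  unfold StrongClass.IsEmb
  rw [Substructure.range_subtype]

/-- `K`-embeddings may be precomposed with isomorphisms. -/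
theorem isEmb_comp_equiv (f : N ↪[L] P) (e : M ≃[L] N) :
    K.IsEmb (f.comp e.toEmbedding) ↔ K.IsEmb f := by
  have : (f.comp e.toEmbedding).toHom.range = f.toHom.range := by
    ext x
    simp only [Hom.mem_range]
    exact ⟨fun ⟨y, hy⟩ => ⟨e y, hy⟩, fun ⟨y, hy⟩ => ⟨e.symm y, by
      simpa using hy⟩⟩
  unfold StrongClass.IsEmb
  rw [this]

/-- `K`-embeddings may be postcomposed with isomorphisms. -/
theorem isEmb_equiv_comp (e : N ≃[L] P) (f : M ↪[L] N) (hf : K.IsEmb f) :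
    K.IsEmb (e.toEmbedding.comp f) := by
  have : (e.toEmbedding.comp f).toHom.range = f.toHom.range.map e.toHom := by
    ext x
    simp [Hom.mem_range, Substructure.mem_map]
  unfold StrongClass.IsEmb
  rw [this]
  exact K.strong_of_iso e _ hf

theorem isEmb_equiv_comp_iff (e : N ≃[L] P) (f : M ↪[L] N) :
    K.IsEmb (e.toEmbedding.comp f) ↔ K.IsEmb f := by
  refine ⟨fun h => ?_, K.isEmb_equiv_comp e f⟩
  have := K.isEmb_equiv_comp e.symm _ h
  convert this using 1
  ext x
  simp

theorem isEmb_comp {g : N ↪[L] P} {f : M ↪[L] N} (hg : K.IsEmb g) (hf : K.IsEmb f) :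
    K.IsEmb (g.comp f) := by
  have hle : (g.comp f).toHom.range ≤ g.toHom.range := by
    intro x hx
    obtain ⟨y, hy⟩ := Hom.mem_range.1 hx
    exact Hom.mem_range.2 ⟨f y, hy⟩
  refine K.strong_trans _ _ ⟨hle, ?_⟩ hg
  rw [← K.isEmb_comp_equiv _ (g.comp f).equivRange]
  exact K.isEmb_equiv_comp g.equivRange f hf

/-- This is coherence, read inside `P` through the isomorphism of `N` with the range of `g`. -/
theorem isEmb_of_comp {g : N ↪[L] P} {f : M ↪[L] N} (hg : K.IsEmb g)
    (hgf : K.IsEmb (g.comp f)) : K.IsEmb f := by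
  have hle : (g.comp f).toHom.range ≤ g.toHom.range := by
    intro x hx
    obtain ⟨y, hy⟩ := Hom.mem_range.1 hx
    exact Hom.mem_range.2 ⟨f y, hy⟩
  obtain ⟨_, h⟩ := K.coherence _ _ hle hgf hg
  rw [← K.isEmb_comp_equiv _ (g.comp f).equivRange] at h
  rw [← K.isEmb_equiv_comp_iff g.equivRange]
  exact h

theorem isEmb_codRestrict {f : M ↪[L] N} (hf : K.IsEmb f) {S : L.Substructure N}
    (hS : K.Strong S) (h : ∀ m, f m ∈ S) : K.IsEmb (f.codRestrict S h) := by
  refine K.isEmb_of_comp ((K.isEmb_subtype_iff S).2 hS) ?_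
  rwa [Embedding.subtype_comp_codRestrict]

theorem strongLE_of_strong {S T : L.Substructure N} (h : S ≤ T) (hS : K.Strong S)
    (hT : K.Strong T) : K.StrongLE S T := K.coherence S T h hS hT

theorem StrongLE.trans {S T U : L.Substructure N} (h₁ : K.StrongLE S T) (h₂ : K.StrongLE T U) :
    K.StrongLE S U := by
  obtain ⟨h, hST⟩ := h₁
  obtain ⟨h', hTU⟩ := h₂
  exact ⟨h.trans h', K.isEmb_comp hTU hST⟩

/-- A substructure of `N` contained in `T`, viewed as a substructure of `T`. -/
def restrictEquiv {S T : L.Substructure N} (h : S ≤ T) : S.comap T.subtype.toHom ≃[L] S where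
  toFun x := ⟨x.1.1, x.2⟩
  invFun x := ⟨⟨x.1, h x.2⟩, x.2⟩
  left_inv _ := rfl
  right_inv _ := rfl
  map_fun' _ _ := rfl
  map_rel' _ _ := Iff.rfl

/-- Allows the chain axioms, which speak of an ambient structure, to be applied with a substructure
`T` in that role. -/
theorem strongLE_comap_iff {S S' T : L.Substructure N} (h : S ≤ T) (h' : S' ≤ T) :
    K.StrongLE (S.comap T.subtype.toHom) (S'.comap T.subtype.toHom) ↔ K.StrongLE S S' := by
  constructor
  · rintro ⟨hle, he⟩
    have hSS : S ≤ S' := fun x hx => hle (show (⟨x, h hx⟩ : T) ∈ _ from hx)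
    refine ⟨hSS, ?_⟩
    rw [← K.isEmb_comp_equiv _ (restrictEquiv h)]
    exact K.isEmb_equiv_comp (restrictEquiv h') _ he
  · rintro ⟨hle, he⟩
    refine ⟨fun x hx => hle hx, ?_⟩
    rw [← K.isEmb_equiv_comp_iff (restrictEquiv h')]
    exact (K.isEmb_comp_equiv _ (restrictEquiv h)).2 he

theorem strong_comap_iff {S T : L.Substructure N} (h : S ≤ T) :
    K.Strong (S.comap T.subtype.toHom) ↔ K.StrongLE S T := by
  rw [← K.isEmb_subtype_iff, ← K.isEmb_comp_equiv _ (restrictEquiv h).symm]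
  exact ⟨fun he => ⟨h, he⟩, fun ⟨_, he⟩ => he⟩

end Embeddings

/-! ### Monotone bounds indexed by finite sets. -/

section Monotone

/-- Over a directed order, a map defined on finite sets has a monotone upper bound. -/
theorem exists_monotone_finset {X : Type*} {α : Type*} [PartialOrder α] [IsDirectedOrder α]
    (base : Finset X → α) : ∃ F : Finset X → α, Monotone F ∧ ∀ e, base e ≤ F e := by
  classical
  have ub : ∀ t : Finset α, t.Nonempty → ∃ m, ∀ a ∈ t, a ≤ m := fun t ht =>
    haveI : Nonempty α := ⟨ht.choose⟩
    t.exists_le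
  choose m hm using ub
  -- `F e` is an upper bound of `base e` and of the finitely many `F e'` with `e' ⊂ e`.
  let F : Finset X → α := fun e => Finset.strongInduction (p := fun _ => α)
    (fun e ih => m (insert (base e) (e.ssubsets.attach.image fun e' =>
      ih e'.1 (Finset.mem_ssubsets.1 e'.2))) (Finset.insert_nonempty _ _)) e
  have hF : ∀ e, F e = m (insert (base e) (e.ssubsets.attach.image fun e' => F e'.1))
      (Finset.insert_nonempty _ _) := fun e => by
    simp only [F]
    rw [Finset.strongInduction_eq]
  refine ⟨F, fun e' e h => ?_, fun e => ?_⟩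
  · rcases h.eq_or_ssubset with rfl | h
    · exact le_rfl
    · rw [hF e]
      refine hm _ _ _ (Finset.mem_insert_of_mem (Finset.mem_image.2
        ⟨⟨e', Finset.mem_ssubsets.2 h⟩, Finset.mem_attach _ _, rfl⟩))
  · rw [hF e]
    exact hm _ _ _ (Finset.mem_insert_self _ _)

end Monotone

/-! ### From continuous chains to directed unions. -/

section DirectedUnions

variable {N : Type u} [L.Structure N]

/-- The union of an increasing family of substructures indexed by a directed order. -/
def directedUnion {D : Type*} [Preorder D] [IsDirectedOrder D] [Nonempty D]
    (S : D → L.Substructure N) (hS : Monotone S) : L.Substructure N where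
  carrier := ⋃ d, (S d : Set N)
  fun_mem {n} f x hx := by
    have hx' : ∀ i, ∃ d, x i ∈ S d := fun i => by simpa using hx i
    choose d hd using hx'
    obtain ⟨c, hc⟩ := Finite.exists_le d
    exact mem_iUnion.2 ⟨c, (S c).fun_mem f x fun i => hS (hc i) (hd i)⟩

/-- The union of a continuous chain inside a structure `N`, as a substructure `T` of `N`. -/
theorem strongLE_chain_union {I : Type u} [LinearOrder I] [WellFoundedLT I] [Nonempty I]
    {S : I → L.Substructure N} (hS : ∀ i j, i ≤ j → K.StrongLE (S i) (S j))
    (hc : IsContinuousFamily S) {T : L.Substructure N} (hT : (T : Set N) = ⋃ i, (S i : Set N)) :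
    (∀ i, K.StrongLE (S i) T) ∧ ∀ U, (∀ i, K.StrongLE (S i) U) → K.StrongLE T U := by
  have hle : ∀ i, S i ≤ T := fun i x hx => by
    rw [← SetLike.mem_coe, hT]
    exact mem_iUnion.2 ⟨i, hx⟩
  have hcont : ∀ U : L.Substructure N,
      IsContinuousFamily fun i => (S i).comap U.subtype.toHom := fun U i hi => by
    ext x
    have := congrArg (x.1 ∈ ·) (hc i hi)
    simpa using this
  constructor
  -- `chain_union` requires the chain to exhaust the ambient structure, so the chain is viewed
  -- inside `T`.
  · obtain ⟨h₁, h₂⟩ := K.chain_union I (fun i => (S i).comap T.subtype.toHom)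
      (fun i j hij => (K.strongLE_comap_iff (hle i) (hle j)).2 (hS i j hij)) (hcont T)
      (by
        ext x
        have := x.2
        rw [← SetLike.mem_coe, hT] at this
        simpa using this)
    exact fun i => (K.strong_comap_iff (hle i)).1 (h₂ i)
  · intro U hU
    have hTU : T ≤ U := fun x hx => by
      rw [← SetLike.mem_coe, hT] at hx
      obtain ⟨i, hi⟩ := mem_iUnion.1 hx
      exact (hU i).1 hi
    rw [← K.strong_comap_iff hTU]
    refine K.chain_smooth I (fun i => (S i).comap U.subtype.toHom)
      (fun i j hij => (K.strongLE_comap_iff (hU i).1 (hU j).1).2 (hS i j hij)) (hcont U)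
      (fun i => (K.strong_comap_iff (hU i).1).2 (hU i)) _ ?_
    ext x
    have := congrArg (x.1 ∈ ·) hT
    simpa using this

/-- Induction on `#Y`: well-order `Y` in type `μ.ord` and write the union as a continuous chain of
the unions over finite subsets of proper initial segments. Indexing by finite sets keeps each of
these subfamilies directed. -/
theorem strongLE_finset_union (μ : Cardinal.{u}) : ∀ (Y : Type u), #Y = μ →
    ∀ (S : Finset Y → L.Substructure N), (∀ e e', e ≤ e' → K.StrongLE (S e) (S e')) →
    ∀ T : L.Substructure N, (T : Set N) = ⋃ e, (S e : Set N) →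
      (∀ e, K.StrongLE (S e) T) ∧ ∀ U, (∀ e, K.StrongLE (S e) U) → K.StrongLE T U := by
  classical
  induction μ using WellFoundedLT.induction with
  | ind μ ih =>
  intro Y hY S hS T hT
  rcases lt_or_ge μ ℵ₀ with hμ | hμ
  · have : Finite Y := Cardinal.lt_aleph0_iff_finite.1 (hY ▸ hμ)
    have := Fintype.ofFinite Y
    have : T = S Finset.univ := by
      apply SetLike.coe_injective
      rw [hT]
      exact subset_antisymm (iUnion_subset fun e => (hS e _ (Finset.subset_univ e)).1)
        (subset_iUnion (fun e => (S e : Set N)) Finset.univ)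
    subst this
    exact ⟨fun e => hS e _ (Finset.subset_univ e), fun U hU => hU _⟩
  obtain ⟨r⟩ : Nonempty (μ.ord.ToType ≃ Y) := Cardinal.eq.1 (by rw [mk_ord_toType, hY])
  -- The family is transported to `μ.ord.ToType`, which has no maximum and whose initial segments
  -- have size below `μ`.
  wlog h : ∃ _ : LinearOrder Y, ∃ _ : WellFoundedLT Y, ∃ _ : NoMaxOrder Y,
      ∀ a : Y, #(Iio a) < μ generalizing Y
  · have hno : NoMaxOrder μ.ord.ToType := Cardinal.noMaxOrder hμ
    have hT' : (T : Set N) = ⋃ e : Finset μ.ord.ToType, (S (e.map r.toEmbedding) : Set N) := by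
      rw [hT]
      refine subset_antisymm (iUnion_subset fun e => ?_) (iUnion_subset fun e =>
        subset_iUnion (fun e => (S e : Set N)) _)
      refine subset_iUnion_of_subset (e.map r.symm.toEmbedding) ?_
      rw [Finset.map_map]
      have : r.symm.toEmbedding.trans r.toEmbedding = Function.Embedding.refl _ := by ext; simp
      rw [this, Finset.map_refl]
    obtain ⟨h₁, h₂⟩ := this μ.ord.ToType (by simp) (fun e => S (e.map r.toEmbedding))
      (fun e e' he => hS _ _ (Finset.map_subset_map.2 he)) hT' (Equiv.refl _)
      ⟨inferInstance, inferInstance, hno, fun a => by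
        simpa using mk_Iio_lt a (by simp)⟩
    have hr : ∀ e : Finset Y, (e.map r.symm.toEmbedding).map r.toEmbedding = e := fun e => by
      rw [Finset.map_map]
      have : r.symm.toEmbedding.trans r.toEmbedding = Function.Embedding.refl _ := by ext; simp
      rw [this, Finset.map_refl]
    exact ⟨fun e => hr e ▸ h₁ (e.map r.symm.toEmbedding), fun U hU => h₂ U fun e => hU _⟩
  obtain ⟨_, _, _, hI⟩ := h
  have : Nonempty Y := ⟨r (Cardinal.nonempty_ord_toType
    (aleph0_pos.trans_le hμ).ne').some⟩
  let emb (a : Y) : Iio a ↪ Y := Function.Embedding.subtype _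
  have hmono : ∀ a : Y, Monotone fun e : Finset (Iio a) => S (e.map (emb a)) :=
    fun a e e' he => (hS _ _ (Finset.map_subset_map.2 he)).1
  let V (a : Y) : L.Substructure N := directedUnion _ (hmono a)
  have hV : ∀ a, _ := fun a => ih _ (hI a) (Iio a) rfl (fun e => S (e.map (emb a)))
    (fun e e' he => hS _ _ (Finset.map_subset_map.2 he)) (V a) rfl
  have hmem : ∀ (a : Y) (e : Finset Y), (∀ y ∈ e, y < a) →
      ∃ e' : Finset (Iio a), e'.map (emb a) = e := fun a e he =>
    ⟨e.subtype (· < a), Finset.subtype_map_of_mem he⟩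
  have hlt : ∀ (a : Y) (e : Finset (Iio a)), ∀ y ∈ e.map (emb a), y < a := fun a e y hy => by
    obtain ⟨z, -, rfl⟩ := Finset.mem_map.1 hy
    exact z.2
  have hSV : ∀ (a : Y) (e : Finset Y), (∀ y ∈ e, y < a) → K.StrongLE (S e) (V a) :=
    fun a e he => by
      obtain ⟨e', rfl⟩ := hmem a e he
      exact (hV a).1 e'
  have hVV : ∀ a b, a ≤ b → K.StrongLE (V a) (V b) := fun a b hab =>
    (hV a).2 _ fun e => hSV b _ fun y hy => (hlt a e y hy).trans_le hab
  have hcont : IsContinuousFamily V := fun a ha => by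
    refine subset_antisymm ?_ (iUnion₂_subset fun b hb => (hVV b a (le_of_lt hb)).1)
    refine iUnion_subset fun e => ?_
    -- Continuity at a limit `a`: a finite set below `a` is already below some `b < a`.
    have key : ∀ e : Finset Y, (∀ y ∈ e, y < a) → ∃ b < a, ∀ y ∈ e, y < b := by
      intro e
      induction e using Finset.induction_on with
      | empty =>
        intro _
        obtain ⟨b, hb⟩ := not_isMin_iff.1 ha.1
        exact ⟨b, hb, by simp⟩
      | insert y e _ ihe =>
        intro he
        obtain ⟨b, hb, hb'⟩ := ihe fun z hz => he z (Finset.mem_insert_of_mem hz)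
        obtain ⟨c, hc, hyc⟩ := (ha.2.lt_iff_exists_lt).1 (he y (Finset.mem_insert_self _ _))
        refine ⟨max b c, max_lt hb hc, fun z hz => ?_⟩
        rcases Finset.mem_insert.1 hz with rfl | hz
        · exact hyc.trans_le (le_max_right _ _)
        · exact (hb' z hz).trans_le (le_max_left _ _)
    obtain ⟨b, hb, hb'⟩ := key _ (hlt a e)
    exact subset_iUnion₂_of_subset b hb (hSV b _ hb').1
  have hTV : (T : Set N) = ⋃ a, (V a : Set N) := by
    rw [hT]
    refine subset_antisymm (iUnion_subset fun e => ?_)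
      (iUnion_subset fun a => iUnion_subset fun e => subset_iUnion (fun e => (S e : Set N)) _)
    obtain ⟨b, hb⟩ := e.exists_le
    obtain ⟨c, hc⟩ := exists_gt b
    exact subset_iUnion_of_subset c (hSV c e fun y hy => (hb y hy).trans_lt hc).1
  obtain ⟨h₁, h₂⟩ := K.strongLE_chain_union hVV hcont hTV
  refine ⟨fun e => ?_, fun U hU => h₂ U fun a => (hV a).2 U fun e => hU _⟩
  obtain ⟨b, hb⟩ := e.exists_le
  obtain ⟨c, hc⟩ := exists_gt b
  exact StrongLE.trans K (hSV c e fun y hy => (hb y hy).trans_lt hc) (h₁ c)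

/-- Directed unions in an abstract elementary class. -/
theorem strongLE_directed_union {D : Type u} [PartialOrder D] [IsDirectedOrder D] [Nonempty D]
    {S : D → L.Substructure N} (hS : ∀ i j, i ≤ j → K.StrongLE (S i) (S j))
    {T : L.Substructure N} (hT : (T : Set N) = ⋃ d, (S d : Set N)) :
    (∀ d, K.StrongLE (S d) T) ∧ ∀ U, (∀ d, K.StrongLE (S d) U) → K.StrongLE T U := by
  -- A monotone `F : Finset D → D` with `d ≤ F {d}` reindexes the family by finite sets without
  -- changing its union.
  choose ub hub using fun e : Finset D => e.exists_le
  obtain ⟨F, hF, hle⟩ := exists_monotone_finset ub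
  have hd : ∀ d, d ≤ F {d} := fun d => (hub {d} d (Finset.mem_singleton_self d)).trans (hle _)
  obtain ⟨h₁, h₂⟩ := K.strongLE_finset_union _ D rfl (fun e => S (F e))
    (fun e e' he => hS _ _ (hF he)) T (by
      rw [hT]
      exact subset_antisymm (iUnion_subset fun d => subset_iUnion_of_subset {d} (hS _ _ (hd d)).1)
        (iUnion_subset fun e => subset_iUnion (fun d => (S d : Set N)) _))
  exact ⟨fun d => StrongLE.trans K (hS _ _ (hd d)) (h₁ {d}), fun U hU => h₂ U fun e => hU _⟩

/-- Turns the results on `StrongLE` into results on `Strong`, on taking the ambient substructure to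
be `⊤`. -/
theorem strong_iff_strongLE_top (S : L.Substructure N) : K.Strong S ↔ K.StrongLE S ⊤ := by
  rw [← K.isEmb_subtype_iff]
  constructor
  · intro h
    exact ⟨le_top, (K.isEmb_equiv_comp_iff Substructure.topEquiv _).1 h⟩
  · rintro ⟨h, he⟩
    exact K.isEmb_equiv_comp Substructure.topEquiv _ he

theorem strong_of_directed_union_eq_univ {D : Type u} [PartialOrder D] [IsDirectedOrder D]
    [Nonempty D] {S : D → L.Substructure N} (hS : ∀ i j, i ≤ j → K.StrongLE (S i) (S j))
    (hT : (⋃ d, (S d : Set N)) = Set.univ) (d : D) : K.Strong (S d) :=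
  (K.strong_iff_strongLE_top _).2 ((K.strongLE_directed_union hS (T := ⊤) (by simp [hT])).1 d)

theorem strong_directed_union {D : Type u} [PartialOrder D] [IsDirectedOrder D] [Nonempty D]
    {S : D → L.Substructure N} (hm : Monotone S) (hS : ∀ d, K.Strong (S d))
    {T : L.Substructure N} (hT : (T : Set N) = ⋃ d, (S d : Set N)) : K.Strong T :=
  (K.strong_iff_strongLE_top _).2 ((K.strongLE_directed_union
    (fun i j hij => K.strongLE_of_strong (hm hij) (hS i) (hS j)) hT).2 ⊤
      fun d => (K.strong_iff_strongLE_top _).1 (hS d))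

end DirectedUnions

end AEC
end AECLC

/-! ### Compact filters and coherent choices of indices. -/

namespace AECLC

/-- A filter that is closed under intersections of at most `μ` sets, and relative to which subsets
of the index set can be decided so that each of `θ` many given families of at most `μ` sets is
decided as by a point in a prescribed member of the filter. -/
structure IsCompactFilter {I : Type u} (F : Filter I) (μ θ : Cardinal.{u}) : Prop where
  inter : ∀ {S : Type u} (Y : S → Set I), #S ≤ μ → (∀ s, Y s ∈ F) → (⋂ s, Y s) ∈ F
  decide : ∀ (E : Type u) (G : E → Set (Set I)) (Y : E → Set I), #E ≤ θ →
    (∀ e, #(G e) ≤ μ) → (∀ e, Y e ∈ F) →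
    ∃ v : Set (Set I), ∀ e, ∃ i ∈ Y e, ∀ X ∈ G e, (X ∈ v ↔ i ∈ X)

section Formulas

variable {L : FirstOrder.Language.{u, u}}

theorem mk_formula_le {α : Type u} {μ : Cardinal.{u}} (hμ : ℵ₀ ≤ μ) (hL : L.card ≤ μ)
    (hα : #α ≤ μ) : #(L.Formula α) ≤ μ := by
  have h₁ : #(L.Formula α) ≤ #(Σ n, L.BoundedFormula α n) :=
    mk_le_of_injective (f := fun φ : L.Formula α => (⟨0, φ⟩ : Σ n, L.BoundedFormula α n))
      fun φ ψ h => by simpa using h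
  refine h₁.trans (BoundedFormula.card_le.trans (max_le hμ ?_))
  simpa using add_le_of_le hμ hα hL

/-- A coherent choice of indices along a directed family of small sets of sections. -/
theorem IsCompactFilter.exists_coherent_index {I : Type u} {F : Filter I} {μ θ : Cardinal.{u}}
    (hF : IsCompactFilter F μ θ) (hμ : ℵ₀ ≤ μ) (hL : L.card ≤ μ)
    {P : I → Type u} [∀ i, L.Structure (P i)] {E : Type u} [PartialOrder E] (hE : #E ≤ θ)
    (σ : E → Set (∀ i, P i)) (hσ : ∀ e, #(σ e) ≤ μ) (hm : Monotone σ)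
    (Y : E → Set I) (hY : ∀ e, Y e ∈ F) :
    ∃ ix : E → I, (∀ e, ix e ∈ Y e) ∧ ∀ e e', e ≤ e' → ∀ φ : L.Formula (σ e),
      (φ.Realize (M := P (ix e)) (fun f => f.1 (ix e)) ↔
        φ.Realize (M := P (ix e')) (fun f => f.1 (ix e'))) := by
  -- The sets to be decided are the truth sets of formulas about the sections in `σ e`; there are at
  -- most `μ` of them.
  obtain ⟨v, hv⟩ := hF.decide E
    (fun e => range fun φ : L.Formula (σ e) => {i | φ.Realize (M := P i) fun f => f.1 i})
    Y hE (fun e => mk_range_le.trans (mk_formula_le hμ hL (hσ e))) hY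
  choose ix hix hv using hv
  refine ⟨ix, hix, fun e e' hee φ => ?_⟩
  have h₁ := hv e _ ⟨φ, rfl⟩
  -- Relabelled along `σ e ⊆ σ e'`, the formula keeps its truth set, so `ix e` and `ix e'` both
  -- agree with `v` on that set.
  have h₂ := hv e' {i | φ.Realize (M := P i) fun f => f.1 i}
    ⟨φ.relabel (Set.inclusion (hm hee)), by
      ext i
      simp [Formula.realize_relabel, Function.comp_def]⟩
  exact h₁.symm.trans h₂

/-- A map that preserves and reflects formulas between enumerations is an embedding. -/
theorem exists_embedding_of_realize_iff {A B W : Type u} [L.Structure A] [L.Structure B]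
    (a : W → A) (b : W → B) (h : ∀ φ : L.Formula W, φ.Realize a ↔ φ.Realize b)
    (S : L.Substructure A) (hS : (S : Set A) = range a) :
    ∃ g : S ↪[L] B, ∀ w (hw : a w ∈ S), g ⟨a w, hw⟩ = b w := by
  have hex : ∀ x : S, ∃ w, a w = x := fun x => by
    have := x.2
    rwa [← SetLike.mem_coe, hS] at this
  choose w hw using hex
  have heq : ∀ u v, a u = a v ↔ b u = b v := fun u v => by
    simpa using h (Term.equal (Term.var u) (Term.var v))
  refine ⟨⟨⟨fun x => b (w x), fun x y hxy => ?_⟩, fun {n} F x => ?_, fun {n} R x => ?_⟩,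
    fun u hu => ?_⟩
  · have := (heq _ _).2 hxy
    rw [hw, hw] at this
    exact Subtype.ext this
  · have := h (Term.equal (Term.var (w (Structure.funMap F x)))
      (Term.func F fun i => Term.var (w (x i))))
    simp only [Formula.realize_equal, Term.realize_var, Term.realize_func, hw] at this
    exact this.1 rfl
  · have := h (R.formula fun i => Term.var (w (x i)))
    simp only [Formula.realize_rel, Term.realize_var, hw] at this
    exact this.symm
  · exact (heq _ _).1 (hw _)

end Formulas

/-! ### Direct limits in `K` and amalgams along a compact filter. -/

namespace AEC

variable {L : FirstOrder.Language.{u, u}} (K : AEC L)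

theorem isLSBound_LS : K.IsLSBound K.LS := csInf_mem K.exists_LS

theorem aleph0_le_LS : ℵ₀ ≤ K.LS := K.isLSBound_LS.1

theorem exists_strong_superset {M : Type u} [L.Structure M] (hM : K.Mem M) {μ : Cardinal.{u}}
    (hμ : K.LS ≤ μ) {A : Set M} (hA : #A ≤ μ) :
    ∃ S : L.Substructure M, K.Strong S ∧ A ⊆ S ∧ #S ≤ μ := by
  obtain ⟨S, h₁, h₂, h₃⟩ := K.isLSBound_LS.2.2 M hM A
  exact ⟨S, h₁, h₂, h₃.trans (add_le_of_le (K.aleph0_le_LS.trans hμ) hA hμ)⟩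

section Limits

variable {E : Type u} [PartialOrder E] [IsDirectedOrder E] [Nonempty E]

/-- The maps into a direct limit of `K`-embeddings are `K`-embeddings. -/
theorem isEmb_directLimit_of {G : E → Type u} [∀ e, L.Structure (G e)]
    (f : ∀ i j, i ≤ j → G i ↪[L] G j) [DirectedSystem G fun i j h => f i j h]
    (hf : ∀ i j h, K.IsEmb (f i j h)) (e : E) : K.IsEmb (DirectLimit.of L E G f e) := by
  refine K.strong_of_directed_union_eq_univ
    (S := fun e => (DirectLimit.of L E G f e).toHom.range) (fun i j hij => ?_) ?_ e
  · have hle : (DirectLimit.of L E G f i).toHom.range ≤ (DirectLimit.of L E G f j).toHom.range := by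
      intro x hx
      obtain ⟨y, rfl⟩ := Hom.mem_range.1 hx
      exact Hom.mem_range.2 ⟨f i j hij y, DirectLimit.of_f⟩
    refine ⟨hle, ?_⟩
    rw [← K.isEmb_comp_equiv _ (DirectLimit.of L E G f i).equivRange]
    have h := K.isEmb_equiv_comp (DirectLimit.of L E G f j).equivRange _ (hf i j hij)
    convert h using 1
    ext x
    exact (DirectLimit.of_f (f := f) (hij := hij)).symm
  · refine eq_univ_of_forall fun z => ?_
    obtain ⟨i, x, rfl⟩ := DirectLimit.exists_of z
    exact mem_iUnion.2 ⟨i, Hom.mem_range.2 ⟨x, rfl⟩⟩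

/-- Compatible `K`-embeddings of the members of a directed cover by strong substructures glue to a
`K`-embedding. -/
theorem exists_isEmb_glue {M N : Type u} [L.Structure M] [L.Structure N]
    {B : E → L.Substructure M} (hB : Monotone B) (hcov : ∀ m, ∃ e, m ∈ B e)
    (k : ∀ e, B e ↪[L] N) (hk : ∀ e, K.IsEmb (k e))
    (hc : ∀ e e' (h : e ≤ e') (b : B e), k e' ⟨b, hB h b.2⟩ = k e b) :
    ∃ g : M ↪[L] N, K.IsEmb g ∧ ∀ e (b : B e), g b = k e b := by
  choose ε hε using hcov
  have hval : ∀ e (b : B e), k (ε b) ⟨b, hε b⟩ = k e b := fun e b => by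
    obtain ⟨c, h₁, h₂⟩ := exists_ge_ge (ε b) e
    rw [← hc _ c h₁, ← hc _ c h₂]
  have hfin : ∀ {n : ℕ} (x : Fin n → M), ∃ e, ∀ i, x i ∈ B e := fun x => by
    obtain ⟨c, hc⟩ := Finite.exists_le fun i => ε (x i)
    exact ⟨c, fun i => hB (hc i) (hε _)⟩
  let g : M ↪[L] N :=
    { toFun := fun m => k (ε m) ⟨m, hε m⟩
      inj' := fun x y hxy => by
        obtain ⟨c, h₁, h₂⟩ := exists_ge_ge (ε x) (ε y)
        have hx := hval c ⟨x, hB h₁ (hε x)⟩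
        have hy := hval c ⟨y, hB h₂ (hε y)⟩
        simp only at hx hy hxy
        rw [hx, hy] at hxy
        simpa using (k c).injective hxy
      map_fun' := fun {n} F x => by
        obtain ⟨c, hx⟩ := hfin x
        have h₁ := hval c ⟨Structure.funMap F x, (B c).fun_mem F x hx⟩
        have h₂ : ∀ i, _ := fun i => hval c ⟨x i, hx i⟩
        simp only at h₁ h₂
        rw [h₁]
        simp only [Function.comp_def, h₂]
        exact (k c).map_fun F fun i => ⟨x i, hx i⟩
      map_rel' := fun {n} R x => by
        obtain ⟨c, hx⟩ := hfin x
        have h₂ : ∀ i, _ := fun i => hval c ⟨x i, hx i⟩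
        simp only at h₂
        simp only [Function.comp_def, h₂]
        exact (k c).map_rel R fun i => ⟨x i, hx i⟩ }
  refine ⟨g, ?_, hval⟩
  -- The range of `g` is the directed union of the strong ranges of the `k e`.
  refine K.strong_directed_union (S := fun e => (k e).toHom.range) (fun e e' h => ?_) hk ?_
  · intro x hx
    obtain ⟨y, rfl⟩ := Hom.mem_range.1 hx
    exact Hom.mem_range.2 ⟨⟨y, hB h y.2⟩, hc e e' h y⟩
  · ext x
    simp only [Hom.range_coe, Set.mem_range, mem_iUnion]
    constructor
    · rintro ⟨m, rfl⟩
      exact ⟨ε m, ⟨m, hε m⟩, rfl⟩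
    · rintro ⟨e, b, rfl⟩
      exact ⟨b, hval e b⟩

/-- The limit model generated by a directed family of small sets of sections, each of which
evaluates to a strong submodel at every index. -/
theorem exists_limit {I : Type u} {F : Filter I} {θ : Cardinal.{u}}
    (hF : IsCompactFilter F K.LS θ)
    {P : I → Type u} [∀ i, L.Structure (P i)] (hE : #E ≤ θ)
    (σ : E → Set (∀ i, P i)) (hσ : ∀ e, #(σ e) ≤ K.LS) (hm : Monotone σ)
    (S : E → ∀ i, L.Substructure (P i)) (hS : ∀ e i, K.Strong (S e i))
    (hSσ : ∀ e i, (S e i : Set (P i)) = (fun f : ∀ i, P i => f i) '' σ e)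
    (Y : E → Set I) (hY : ∀ e, Y e ∈ F) :
    ∃ (N : Type u) (_ : L.Structure N) (ix : E → I) (ι : ∀ e, S e (ix e) ↪[L] N),
      (∀ e, ix e ∈ Y e) ∧ (∀ e, K.IsEmb (ι e)) ∧
      ∀ e e', e ≤ e' → ∀ f ∈ σ e, ∀ (h : f (ix e) ∈ S e (ix e)) (h' : f (ix e') ∈ S e' (ix e')),
        ι e ⟨f (ix e), h⟩ = ι e' ⟨f (ix e'), h'⟩ := by
  obtain ⟨ix, hix, hφ⟩ := hF.exists_coherent_index K.aleph0_le_LS K.isLSBound_LS.2.1 hE σ hσ hm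
    Y hY
  have hmem : ∀ e e' i, e ≤ e' → ∀ f ∈ σ e, f i ∈ S e' i := fun e e' i h f hf => by
    rw [← SetLike.mem_coe, hSσ]
    exact ⟨f, hm h hf, rfl⟩
  have hrange : ∀ e i, (S e i : Set (P i)) = range fun f : σ e => f.1 i := fun e i => by
    rw [hSσ, image_eq_range]
  have hex : ∀ e e' (_ : e ≤ e'), ∃ g : S e (ix e) ↪[L] S e' (ix e'), K.IsEmb g ∧
      ∀ f ∈ σ e, ∀ h, (g ⟨f (ix e), h⟩ : P (ix e')) = f (ix e') := fun e e' hee => by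
    obtain ⟨g, hg⟩ := exists_embedding_of_realize_iff (fun f : σ e => f.1 (ix e))
      (fun f => f.1 (ix e')) (hφ e e' hee) (S e (ix e)) (hrange _ _)
    -- The image of `S e (ix e)` consists of the values of the same sections at `ix e'`. It is
    -- strong in `P (ix e')` since `σ e` evaluates to a strong submodel at every index, and
    -- coherence then makes it strong in `S e' (ix e')`.
    have hgr : (g.toHom.range : Set (P (ix e'))) = S e (ix e') := by
      rw [hrange]
      ext x
      simp only [Hom.range_coe, Set.mem_range]
      constructor
      · rintro ⟨⟨y, hy⟩, rfl⟩
        obtain ⟨f, rfl⟩ : y ∈ range fun f : σ e => f.1 (ix e) := by rw [← hrange]; exact hy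
        exact ⟨f, (hg f hy).symm⟩
      · rintro ⟨f, rfl⟩
        exact ⟨⟨f.1 (ix e), hmem e e _ le_rfl f f.2⟩, hg f _⟩
    have hcod : ∀ x, g x ∈ S e' (ix e') := fun x => by
      have : g x ∈ (g.toHom.range : Set (P (ix e'))) := Hom.mem_range.2 ⟨x, rfl⟩
      rw [hgr, hSσ] at this
      obtain ⟨f, hf, hfx⟩ := this
      rw [← hfx]
      exact hmem e e' _ hee f hf
    refine ⟨g.codRestrict _ hcod, ?_, fun f hf h => hg ⟨f, hf⟩ h⟩
    refine K.isEmb_codRestrict ?_ (hS e' (ix e')) hcod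
    show K.Strong g.toHom.range
    rw [SetLike.coe_injective hgr]
    exact hS e _
  choose g hg hgf using hex
  have hform : ∀ e (x : S e (ix e)), ∃ f ∈ σ e, ∃ h, x = ⟨f (ix e), h⟩ := fun e x => by
    have := x.2
    rw [← SetLike.mem_coe, hSσ] at this
    obtain ⟨f, hf, hfx⟩ := this
    exact ⟨f, hf, hmem e e _ le_rfl f hf, Subtype.ext hfx.symm⟩
  have : DirectedSystem (fun e => S e (ix e)) fun i j h => g i j h :=
    { map_self := fun e x => by
        obtain ⟨f, hf, h, rfl⟩ := hform e x
        exact Subtype.ext (hgf _ _ _ f hf h)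
      map_map := fun c b a hab hbc x => by
        obtain ⟨f, hf, h, rfl⟩ := hform _ x
        have h₁ : g _ _ hab ⟨f (ix a), h⟩ = ⟨f (ix b), hmem _ _ _ hab f hf⟩ :=
          Subtype.ext (hgf _ _ _ f hf h)
        rw [h₁]
        exact Subtype.ext ((hgf b c hbc f (hm hab hf) (hmem _ _ _ hab f hf)).trans
          (hgf a c (hab.trans hbc) f hf h).symm) }
  refine ⟨Language.DirectLimit (fun e => S e (ix e)) g, inferInstance, ix,
    fun e => DirectLimit.of L E _ g e, hix, K.isEmb_directLimit_of g hg, ?_⟩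
  intro e e' hee f hf h h'
  rw [← DirectLimit.of_f (hij := hee)]
  congr 1
  exact Subtype.ext (hgf _ _ _ f hf h)

end Limits

/-- A structure in `K` is covered by a directed family of small strong substructures, indexed by
the finite subsets of any type mapping to it. -/
theorem exists_strong_cover {M X : Type u} [L.Structure M] (hM : K.Mem M) (p : X → Option M) :
    ∃ B : Finset X → L.Substructure M, Monotone B ∧ (∀ e, K.Strong (B e)) ∧
      (∀ e, #(B e) ≤ K.LS) ∧ ∀ e, ∀ x ∈ e, ∀ m, p x = some m → m ∈ B e := by
  -- By Löwenheim–Skolem the small strong substructures form a directed order, to which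
  -- `exists_monotone_finset` applies.
  let α := {B : L.Substructure M // K.Strong B ∧ #B ≤ K.LS}
  have : IsDirectedOrder α := ⟨fun B C => by
    obtain ⟨S, h₁, h₂, h₃⟩ := K.exists_strong_superset hM le_rfl (A := (B.1 ∪ C.1 : Set M))
      ((mk_union_le _ _).trans (add_le_of_le K.aleph0_le_LS B.2.2 C.2.2))
    exact ⟨⟨S, h₁, h₃⟩, fun x hx => h₂ (Or.inl hx), fun x hx => h₂ (Or.inr hx)⟩⟩
  have hbase : ∀ e : Finset X, ∃ B : α, ∀ x ∈ e, ∀ m, p x = some m → m ∈ B.1 := fun e => by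
    have hfin : {m | ∃ x ∈ e, p x = some m}.Finite := by
      have h := (e.finite_toSet.image p).preimage (Option.some_injective M).injOn
      refine h.subset ?_
      rintro m ⟨x, hx, hm⟩
      exact ⟨x, hx, hm⟩
    obtain ⟨S, h₁, h₂, h₃⟩ := K.exists_strong_superset hM le_rfl
      (hfin.lt_aleph0.le.trans K.aleph0_le_LS)
    exact ⟨⟨S, h₁, h₃⟩, fun x hx m hm => h₂ ⟨x, hx, hm⟩⟩
  choose base hbase using hbase
  obtain ⟨B, hB, hle⟩ := exists_monotone_finset base
  exact ⟨fun e => (B e).1, hB, fun e => (B e).2.1, fun e => (B e).2.2,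
    fun e x hx m hm => hle e (hbase e x hx m hm)⟩

/-- A small set of sections extends to a small set that evaluates to strong submodels. -/
theorem exists_strong_sections {I : Type u} {P : I → Type u} [∀ i, L.Structure (P i)]
    [∀ i, Nonempty (P i)] (hP : ∀ i, K.Mem (P i)) {C : Set (∀ i, P i)} (hC : #C ≤ K.LS) :
    ∃ D : Set (∀ i, P i), C ⊆ D ∧ #D ≤ K.LS ∧ ∀ i, ∃ S : L.Substructure (P i), K.Strong S ∧
      (S : Set (P i)) = (fun f : ∀ i, P i => f i) '' D := by
  -- The inserted point makes `S i` nonempty even when `C` is empty, so that `S i` can be enumerated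
  -- by `LS(K)`.
  have h : ∀ i, ∃ S : L.Substructure (P i), K.Strong S ∧
      insert (Classical.arbitrary (P i)) ((fun f : ∀ i, P i => f i) '' C) ⊆ (S : Set (P i)) ∧
      #S ≤ K.LS := fun i => by
    refine K.exists_strong_superset (hP i) le_rfl (mk_insert_le.trans ?_)
    exact add_le_of_le K.aleph0_le_LS (mk_image_le.trans hC)
      (one_le_aleph0.trans K.aleph0_le_LS)
  choose S hS hCS hcard using h
  have hsurj : ∀ i, ∃ g : K.LS.out → S i, Function.Surjective g := fun i => by
    have : Nonempty (S i) := ⟨⟨_, hCS i (mem_insert _ _)⟩⟩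
    obtain ⟨e⟩ : Nonempty (S i ↪ K.LS.out) := by
      rw [← Cardinal.le_def, mk_out]
      exact hcard i
    exact ⟨Function.invFun e, Function.invFun_surjective e.injective⟩
  choose g hg using hsurj
  -- For each `w`, the new section takes the `w`-th element of `S i` at all `i` at once, so `LS(K)`
  -- new sections fill every `S i`.
  refine ⟨C ∪ range fun w i => (g i w : P i), subset_union_left, ?_, fun i => ⟨S i, hS i, ?_⟩⟩
  · refine (mk_union_le _ _).trans (add_le_of_le K.aleph0_le_LS hC (mk_range_le.trans ?_))
    rw [mk_out]
  · refine subset_antisymm (fun x hx => ?_) ?_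
    · obtain ⟨w, hw⟩ := hg i ⟨x, hx⟩
      exact ⟨_, Or.inr ⟨w, rfl⟩, congrArg Subtype.val hw⟩
    · rintro _ ⟨f, hf | ⟨w, rfl⟩, rfl⟩
      · exact hCS i (mem_insert_of_mem _ ⟨f, hf, rfl⟩)
      · exact (g i w).2

/-- A directed family of sets of sections extending a given one, with strong evaluations. -/
theorem exists_strong_sections_family {I X : Type u} {P : I → Type u} [∀ i, L.Structure (P i)]
    [∀ i, Nonempty (P i)] (hP : ∀ i, K.Mem (P i)) (C : Finset X → Set (∀ i, P i))
    (hC : ∀ e, #(C e) ≤ K.LS) :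
    ∃ σ : Finset X → Set (∀ i, P i), Monotone σ ∧ (∀ e, C e ⊆ σ e) ∧ (∀ e, #(σ e) ≤ K.LS) ∧
      ∀ e i, ∃ S : L.Substructure (P i), K.Strong S ∧
        (S : Set (P i)) = (fun f : ∀ i, P i => f i) '' σ e := by
  let α := {D : Set (∀ i, P i) // #D ≤ K.LS ∧ ∀ i, ∃ S : L.Substructure (P i), K.Strong S ∧
    (S : Set (P i)) = (fun f : ∀ i, P i => f i) '' D}
  have : IsDirectedOrder α := ⟨fun B C => by
    obtain ⟨D, h₁, h₂, h₃⟩ := K.exists_strong_sections hP (C := B.1 ∪ C.1)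
      ((mk_union_le _ _).trans (add_le_of_le K.aleph0_le_LS B.2.1 C.2.1))
    exact ⟨⟨D, h₂, h₃⟩, fun x hx => h₁ (Or.inl hx), fun x hx => h₁ (Or.inr hx)⟩⟩
  choose D h₁ h₂ h₃ using fun e => K.exists_strong_sections hP (hC e)
  obtain ⟨B, hB, hle⟩ := exists_monotone_finset fun e => (⟨D e, h₂ e, h₃ e⟩ : α)
  exact ⟨fun e => (B e).1, hB, fun e => (h₁ e).trans (hle e), fun e => (B e).2.1,
    fun e => (B e).2.2⟩

/-- Extend an embedding of a substructure by an arbitrary value. -/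
noncomputable def sectionOf {I M : Type u} [L.Structure M] {P : I → Type u}
    [∀ i, L.Structure (P i)] [∀ i, Nonempty (P i)] {N : I → L.Substructure M}
    (g : ∀ i, N i ↪[L] P i) (m : M) (i : I) : P i :=
  -- The default never affects the maps into the limit, which evaluate this section only at indices
  -- with `m ∈ N i`.
  open Classical in if h : m ∈ N i then g i ⟨m, h⟩ else Classical.arbitrary _

theorem sectionOf_apply {I M : Type u} [L.Structure M] {P : I → Type u}
    [∀ i, L.Structure (P i)] [∀ i, Nonempty (P i)] {N : I → L.Substructure M}
    (g : ∀ i, N i ↪[L] P i) {m : M} {i : I} (h : m ∈ N i) : sectionOf g m i = g i ⟨m, h⟩ :=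
  dif_pos h

/-- A structure whose approximations embed into the `P i` embeds into the limit of the `P i`. -/
theorem exists_isEmb_limit {I E M N : Type u} [PartialOrder E] [IsDirectedOrder E] [Nonempty E]
    [L.Structure M] [L.Structure N] {P : I → Type u} [∀ i, L.Structure (P i)]
    [∀ i, Nonempty (P i)] {A : I → L.Substructure M} (hA : ∀ i, K.Strong (A i))
    {g : ∀ i, A i ↪[L] P i} (hg : ∀ i, K.IsEmb (g i))
    {B : E → L.Substructure M} (hB : Monotone B) (hBs : ∀ e, K.Strong (B e))
    (hcov : ∀ m, ∃ e, m ∈ B e) {σ : E → Set (∀ i, P i)}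
    {S : E → ∀ i, L.Substructure (P i)} (hS : ∀ e i, K.Strong (S e i))
    (hSσ : ∀ e i, (S e i : Set (P i)) = (fun f : ∀ i, P i => f i) '' σ e)
    (hBσ : ∀ e, ∀ b ∈ B e, sectionOf g b ∈ σ e) {ix : E → I} (hix : ∀ e, B e ≤ A (ix e))
    {ι : ∀ e, S e (ix e) ↪[L] N} (hι : ∀ e, K.IsEmb (ι e))
    (hc : ∀ e e', e ≤ e' → ∀ f ∈ σ e, ∀ (h : f (ix e) ∈ S e (ix e))
      (h' : f (ix e') ∈ S e' (ix e')), ι e ⟨f (ix e), h⟩ = ι e' ⟨f (ix e'), h'⟩) :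
    ∃ h : M ↪[L] N, K.IsEmb h ∧
      ∀ e b, b ∈ B e → ∃ hs : sectionOf g b (ix e) ∈ S e (ix e), h b = ι e ⟨_, hs⟩ := by
  have hmem : ∀ e, ∀ b ∈ B e, sectionOf g b (ix e) ∈ S e (ix e) := fun e b hb => by
    rw [← SetLike.mem_coe, hSσ]
    exact ⟨_, hBσ e b hb, rfl⟩
  have happ : ∀ e (b : B e), (g (ix e)).comp (Substructure.inclusion (hix e)) b =
      sectionOf g b.1 (ix e) := fun e b => (sectionOf_apply g (hix e b.2)).symm
  let r (e : E) : B e ↪[L] S e (ix e) :=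
    ((g (ix e)).comp (Substructure.inclusion (hix e))).codRestrict _ fun b => by
      rw [happ]
      exact hmem e b b.2
  have hr : ∀ e (b : B e), r e b = ⟨sectionOf g b.1 (ix e), hmem e b b.2⟩ := fun e b =>
    Subtype.ext (happ e b)
  have hrK : ∀ e, K.IsEmb (r e) := fun e => K.isEmb_codRestrict
    (K.isEmb_comp (hg _) (K.strongLE_of_strong (hix e) (hBs e) (hA _)).2) (hS e (ix e)) _
  obtain ⟨h, hh, hval⟩ := K.exists_isEmb_glue hB hcov (fun e => (ι e).comp (r e))
    (fun e => K.isEmb_comp (hι e) (hrK e)) (fun e e' hee b => by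
      simp only [Embedding.comp_apply, hr]
      exact (hc e e' hee _ (hBσ e b b.2) _ _).symm)
  refine ⟨h, hh, fun e b hb => ⟨hmem e b hb, ?_⟩⟩
  rw [hval e ⟨b, hb⟩, Embedding.comp_apply, hr]

/-- Two extensions whose approximations amalgamate along a compact filter amalgamate. -/
theorem exists_amalgam {I : Type u} {F : Filter I} {θ : Cardinal.{u}}
    (hF : IsCompactFilter F K.LS θ) (hθ : K.LS ≤ θ) {M M₁ M₂ : Type u} [L.Structure M]
    [L.Structure M₁] [L.Structure M₂] (h₁ : #M₁ ≤ θ) (h₂ : #M₂ ≤ θ)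
    (f₁ : M ↪[L] M₁) (f₂ : M ↪[L] M₂) (hM₁ : K.Mem M₁) (hM₂ : K.Mem M₂)
    {A₁ : I → L.Substructure M₁} {A₂ : I → L.Substructure M₂}
    (hA₁ : ∀ i, K.Strong (A₁ i)) (hA₂ : ∀ i, K.Strong (A₂ i))
    (hc₁ : ∀ m, {i | m ∈ A₁ i} ∈ F) (hc₂ : ∀ m, {i | m ∈ A₂ i} ∈ F)
    {P : I → Type u} [∀ i, L.Structure (P i)] [∀ i, Nonempty (P i)]
    {g₁ : ∀ i, A₁ i ↪[L] P i} {g₂ : ∀ i, A₂ i ↪[L] P i}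
    (hg₁ : ∀ i, K.IsEmb (g₁ i)) (hg₂ : ∀ i, K.IsEmb (g₂ i))
    (hag : ∀ m, {i | ∃ (h : f₁ m ∈ A₁ i) (h' : f₂ m ∈ A₂ i), g₁ i ⟨_, h⟩ = g₂ i ⟨_, h'⟩} ∈ F) :
    ∃ (N : Type u) (_ : L.Structure N) (k₁ : M₁ ↪[L] N) (k₂ : M₂ ↪[L] N),
      K.IsEmb k₁ ∧ K.IsEmb k₂ ∧ ∀ m : M, k₁ (f₁ m) = k₂ (f₂ m) := by
  classical
  have hinf := K.aleph0_le_LS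
  -- One index set serves the covers of both models and the sections, so all of them share the
  -- indices `ix e`.
  let X := M₁ ⊕ M₂
  have hX : #(Finset X) ≤ θ := by
    have hX' : #X ≤ θ := by
      rw [mk_sum, lift_id, lift_id]
      exact add_le_of_le (hinf.trans hθ) h₁ h₂
    rcases finite_or_infinite X with h | h
    · exact (lt_aleph0_of_finite (Finset X)).le.trans (hinf.trans hθ)
    · rwa [mk_finset_of_infinite]
  obtain ⟨B₁, hB₁, hB₁s, hB₁c, hB₁m⟩ := K.exists_strong_cover hM₁ (X := X)
    (Sum.elim some fun _ => none)
  obtain ⟨B₂, hB₂, hB₂s, hB₂c, hB₂m⟩ := K.exists_strong_cover hM₂ (X := X)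
    (Sum.elim (fun _ => none) some)
  have hP : ∀ i, K.Mem (P i) := fun i => K.mem_target_of_isEmb (hg₁ i)
  obtain ⟨σ, hσ, hCσ, hσc, hσs⟩ := K.exists_strong_sections_family hP (X := X)
    (fun e => sectionOf g₁ '' (B₁ e) ∪ sectionOf g₂ '' (B₂ e)) (fun e =>
      (mk_union_le _ _).trans (add_le_of_le hinf (mk_image_le.trans (hB₁c e))
        (mk_image_le.trans (hB₂c e))))
  choose S hS hSσ using hσs
  let ag (m : M) : Set I :=
    {i | ∃ (h : f₁ m ∈ A₁ i) (h' : f₂ m ∈ A₂ i), g₁ i ⟨_, h⟩ = g₂ i ⟨_, h'⟩}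
  -- The indices at which `B₁ e` and `B₂ e` lie in the approximations and the two maps agree on the
  -- part of `M` sent into `B₁ e`.
  let Y (e : Finset X) : Set I := (⋂ b : B₁ e, {i | b.1 ∈ A₁ i}) ∩ (⋂ b : B₂ e, {i | b.1 ∈ A₂ i}) ∩
    ⋂ m : f₁ ⁻¹' (B₁ e : Set M₁), ag m.1
  have hY : ∀ e, Y e ∈ F := fun e => by
    refine Filter.inter_mem (Filter.inter_mem ?_ ?_) ?_
    · exact hF.inter _ (hB₁c e) fun b => hc₁ b
    · exact hF.inter _ (hB₂c e) fun b => hc₂ b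
    · exact hF.inter _ ((mk_preimage_of_injective _ _ f₁.injective).trans (hB₁c e)) fun m => hag m
  obtain ⟨N, _, ix, ι, hix, hι, hιc⟩ := K.exists_limit hF hX σ hσc hσ S hS hSσ Y hY
  obtain ⟨k₁, hk₁, hv₁⟩ := K.exists_isEmb_limit hA₁ hg₁ hB₁ hB₁s
    (fun m => ⟨{Sum.inl m}, hB₁m _ _ (Finset.mem_singleton_self _) m rfl⟩) hS hSσ
    (fun e b hb => hCσ e (Or.inl ⟨b, hb, rfl⟩))
    (fun e b hb => mem_iInter.1 (hix e).1.1 ⟨b, hb⟩) hι hιc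
  obtain ⟨k₂, hk₂, hv₂⟩ := K.exists_isEmb_limit hA₂ hg₂ hB₂ hB₂s
    (fun m => ⟨{Sum.inr m}, hB₂m _ _ (Finset.mem_singleton_self _) m rfl⟩) hS hSσ
    (fun e b hb => hCσ e (Or.inr ⟨b, hb, rfl⟩))
    (fun e b hb => mem_iInter.1 (hix e).1.2 ⟨b, hb⟩) hι hιc
  refine ⟨N, inferInstance, k₁, k₂, hk₁, hk₂, fun m => ?_⟩
  -- For this `e`, both images of `m` are computed at the single index `ix e`, where `P (ix e)`
  -- already identifies them.
  let e : Finset X := {Sum.inl (f₁ m), Sum.inr (f₂ m)}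
  have hm₁ : f₁ m ∈ B₁ e := hB₁m e (Sum.inl (f₁ m)) (by simp [e]) _ rfl
  have hm₂ : f₂ m ∈ B₂ e := hB₂m e (Sum.inr (f₂ m)) (by simp [e]) _ rfl
  obtain ⟨s₁, e₁⟩ := hv₁ e _ hm₁
  obtain ⟨s₂, e₂⟩ := hv₂ e _ hm₂
  obtain ⟨h, h', hh⟩ := mem_iInter.1 (hix e).2 ⟨m, hm₁⟩
  rw [e₁, e₂]
  congr 2
  rw [sectionOf_apply g₁ h, sectionOf_apply g₂ h', hh]

end AEC
end AECLC

namespace AECLC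

/-! ### Sources of compact filters -/

/-- A `κ`-complete filter contains the intersection of any family of fewer than `κ` members. -/
theorem iInter_mem_of_complete {I : Type u} {F : Filter I} {κ : Cardinal.{u}}
    (hF : ∀ 𝒮 : Set (Set I), #𝒮 < κ → (∀ A ∈ 𝒮, A ∈ F) → ⋂₀ 𝒮 ∈ F) {S : Type u} (Y : S → Set I)
    (hS : #S < κ) (hY : ∀ s, Y s ∈ F) : (⋂ s, Y s) ∈ F := by
  rw [← sInter_range]
  refine hF _ (mk_range_le.trans_lt hS) ?_
  rintro _ ⟨s, rfl⟩
  exact hY s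

/-- A `κ`-complete ultrafilter is a compact filter. -/
theorem isCompactFilter_of_complete {I : Type u} (U : Ultrafilter I) {κ μ θ : Cardinal.{u}}
    (hU : ∀ 𝒮 : Set (Set I), #𝒮 < κ → (∀ A ∈ 𝒮, A ∈ U) → ⋂₀ 𝒮 ∈ U) (hμ : μ < κ) :
    IsCompactFilter (U : Filter I) μ θ where
  inter Y hS hY := iInter_mem_of_complete (F := (U : Filter I)) hU Y (hS.trans_lt hμ) hY
  decide E G Y _ hG hY := by
    classical
    refine ⟨{X | X ∈ U}, fun e => ?_⟩
    have h := iInter_mem_of_complete (F := (U : Filter I)) hU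
      (fun X : G e => if X.1 ∈ U then X.1 else X.1ᶜ) ((hG e).trans_lt hμ) fun X => by
        split_ifs with hX
        · exact hX
        · exact Ultrafilter.compl_mem_iff_notMem.2 hX
    obtain ⟨i, hi, hi'⟩ := U.nonempty_of_mem (Filter.inter_mem (hY e) h)
    refine ⟨i, hi, fun X hX => ?_⟩
    have := mem_iInter.1 hi' ⟨X, hX⟩
    by_cases hXU : X ∈ U
    · simpa [hXU] using this
    · simpa [hXU] using this

/-- `T` may live in another universe, because sets of `L_{κ,κ}`-sentences lie one universe up. -/
theorem exists_forall_le_of_isRegular {κ : Cardinal.{u}} (hκ : κ.IsRegular) {T : Type v}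
    (hT : Cardinal.lift.{u} #T < Cardinal.lift.{v} κ) (f : T → κ.ord.ToType) :
    ∃ i, ∀ t, f t ≤ i := by
  have h : ¬ IsCofinal (range f) := fun h => by
    have h₁ := Order.cof_le h
    rw [Ordinal.cof_toType, hκ.cof_ord] at h₁
    have h₂ : Cardinal.lift.{v} #(range f) ≤ Cardinal.lift.{u} #T := mk_range_le_lift
    exact absurd (Cardinal.lift_le.{v}.2 h₁) (not_le.2 (h₂.trans_lt hT))
  simp only [IsCofinal, not_forall, not_exists, not_and, not_le] at h
  obtain ⟨i, hi⟩ := h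
  exact ⟨i, fun t => (hi _ ⟨t, rfl⟩).le⟩

/-! ### Weakly compact cardinals: the tail filter is compact. -/

namespace IsWeaklyCompact

/-- The language with a relation symbol for each subset of `I`. -/
def subsetLanguage (I : Type u) : FirstOrder.Language.{u, u} := ⟨fun _ => PEmpty, fun _ => Set I⟩

/-- The propositional variable attached to a subset of `I`. -/
def atom {I : Type u} (κ : Cardinal.{u}) (X : Set I) : InfSentence (subsetLanguage I) κ :=
  .rel (n := 0) X Fin.elim0

open Classical in
/-- Some `i ∈ Y` agrees with the truth assignment on the sets in `G`. -/
noncomputable def patternSentence {I : Type u} {κ : Cardinal.{u}} (G : Set (Set I)) (Y : Set I)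
    (hG : #G < κ) (hG' : #(Set G) < κ) : InfSentence (subsetLanguage I) κ :=
  -- A disjunction, written `¬⋀¬`, over the traces on `G` of points of `Y`. There are at most `2 ^
  -- #G` traces, fewer than `κ` by `hG'`.
  .neg <| .conj {p : Set G // ∃ i ∈ Y, p = {X | i ∈ X.1}} ((mk_subtype_le _).trans_lt hG')
    fun p => .neg <| .conj G hG fun X => if X ∈ p.1 then atom κ X.1 else .neg (atom κ X.1)

theorem realize_patternSentence {I : Type u} {κ : Cardinal.{u}} {G : Set (Set I)} {Y : Set I}
    {hG : #G < κ} {hG' : #(Set G) < κ} (M : Type u) [(subsetLanguage I).Structure M] :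
    (patternSentence G Y hG hG').Realize M PEmpty.elim ↔
      ∃ i ∈ Y, ∀ X ∈ G, ((atom κ X).Realize M PEmpty.elim ↔ i ∈ X) := by
  simp only [patternSentence, InfFormula.Realize, not_forall, not_exists, not_not]
  constructor
  · rintro ⟨⟨p, i, hi, rfl⟩, h⟩
    refine ⟨i, hi, fun X hX => ?_⟩
    have := h ⟨X, hX⟩
    simp only [mem_ofPred_eq] at this
    split_ifs at this with hiX
    · exact ⟨fun _ => hiX, fun _ => this⟩
    · exact ⟨fun h => absurd h this, fun h => absurd h hiX⟩
  · rintro ⟨i, hi, h⟩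
    refine ⟨⟨{X | i ∈ X.1}, i, hi, rfl⟩, fun X => ?_⟩
    have := h X.1 X.2
    simp only [mem_ofPred_eq]
    split_ifs with hiX
    · exact this.2 hiX
    · exact fun h => hiX (this.1 h)

/-- If `κ` is weakly compact then the filter of tails of `κ` is compact. -/
theorem isCompactFilter {κ μ : Cardinal.{u}} (h : IsWeaklyCompact κ) (hμ : μ < κ) :
    IsCompactFilter (Filter.atTop : Filter κ.ord.ToType) μ κ := by
  have : Nonempty κ.ord.ToType := Cardinal.nonempty_ord_toType h.1.ne_zero
  constructor
  · intro S Y hS hY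
    choose a ha using fun s => Filter.mem_atTop_sets.1 (hY s)
    obtain ⟨i, hi⟩ := exists_forall_le_of_isRegular h.1.isRegular
      (Cardinal.lift_lt.2 (hS.trans_lt hμ)) a
    exact Filter.mem_atTop_sets.2 ⟨i, fun b hb => mem_iInter.2 fun s => ha s b ((hi s).trans hb)⟩
  · intro E G Y hE hG hY
    have hG₁ : ∀ e, #(G e) < κ := fun e => (hG e).trans_lt hμ
    have hG₂ : ∀ e, #(Set (G e)) < κ := fun e => by
      rw [mk_set]
      exact h.1.isStrongPrelimit (hG₁ e)
    let χ (e : E) : InfSentence (subsetLanguage κ.ord.ToType) κ :=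
      patternSentence (G e) (Y e) (hG₁ e) (hG₂ e)
    obtain ⟨M, _, -, hM⟩ := h.2 _ (range χ) (by
        have := mk_range_le_lift (f := χ)
        rw [Cardinal.lift_id'.{u, u + 1}] at this
        exact this.trans (Cardinal.lift_le.2 hE)) (by
      intro T₀ hT₀ hcard
      choose c hc using fun φ : T₀ => hT₀ φ.2
      choose a ha using fun e => Filter.mem_atTop_sets.1 (hY e)
      obtain ⟨i, hi⟩ := exists_forall_le_of_isRegular h.1.isRegular
        (by rwa [Cardinal.lift_id'.{u, u + 1}]) fun φ => a (c φ)
      -- Fewer than `κ` sentences involve fewer than `κ` tails, which have a common point `i`; the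
      -- atom of `X` is read as `i ∈ X`.
      let str : (subsetLanguage κ.ord.ToType).Structure PUnit.{u + 1} :=
        { funMap := fun f => f.elim
          RelMap := fun (X : Set κ.ord.ToType) _ => i ∈ X }
      refine ⟨PUnit, str, inferInstance, fun φ hφ => ?_⟩
      have hφc : χ (c ⟨φ, hφ⟩) = φ := hc ⟨φ, hφ⟩
      rw [← hφc]
      exact (realize_patternSentence _).2 ⟨i, ha _ _ (hi _), fun X _ => Iff.rfl⟩)
    exact ⟨{X | (atom κ X).Realize M PEmpty.elim}, fun e =>
      (realize_patternSentence M).1 (hM _ ⟨e, rfl⟩)⟩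

end IsWeaklyCompact

/-! ### Measurable cardinals: complete nonprincipal ultrafilters. -/

section Measurable

variable {κ : Cardinal.{u}}

/-- A two-valued measure gives rise to a complete nonprincipal ultrafilter. -/
theorem IsMeasurable.exists_ultrafilter (h : IsMeasurable κ) :
    ∃ U : Ultrafilter κ.ord.ToType,
      (∀ 𝒮 : Set (Set κ.ord.ToType), #𝒮 < κ → (∀ A ∈ 𝒮, A ∈ U) → ⋂₀ 𝒮 ∈ U) ∧
      ∀ a, {a}ᶜ ∈ U := by
  classical
  obtain ⟨hκ, m, h01, huniv, hpt, hadd⟩ := h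
  have hempty : m ∅ = 0 := by
    have := hadd ∅ (by simpa using aleph0_pos.trans hκ) (by simp)
    simpa using this
  have hbin : ∀ A B, Disjoint A B → m (A ∪ B) = m A + m B := fun A B hAB => by
    -- If `A = B` the pair collapses to a singleton and additivity over it says nothing, but
    -- disjointness then forces `A = ∅`.
    by_cases hne : A = B
    · subst hne
      have : A = ∅ := by simpa using hAB
      simp [this, hempty]
    · have h₁ := hadd {A, B} ((lt_aleph0_of_finite _).trans hκ)
        (by
          exact pairwise_pair.2 fun _ => ⟨hAB, hAB.symm⟩)
      rw [sUnion_pair] at h₁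
      rw [h₁, tsum_subtype ({A, B} : Set (Set κ.ord.ToType)) m,
        tsum_eq_sum (s := {A, B}) (fun x hx => by simp_all), Finset.sum_pair hne]
      simp
  have hmono : ∀ A B, A ⊆ B → m B = 0 → m A = 0 := fun A B hAB hB => by
    have := hbin A (B \ A) disjoint_sdiff_right
    rw [union_sdiff_cancel hAB, hB] at this
    exact (add_eq_zero.1 this.symm).1
  have hnull : ∀ 𝒮 : Set (Set κ.ord.ToType), #𝒮 < κ → (∀ A ∈ 𝒮, m A = 0) → m (⋃₀ 𝒮) = 0 := by
    intro 𝒮 hcard hzero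
    -- Additivity concerns disjoint families only, so from each set the earlier ones in a well-order
    -- are removed.
    let f : 𝒮 → Set κ.ord.ToType := fun A => A.1 \ ⋃ B : {B : 𝒮 // WellOrderingRel B A}, B.1.1
    have hdis : Pairwise fun A B => Disjoint (f A) (f B) := by
      have key : ∀ A B : 𝒮, WellOrderingRel A B → Disjoint (f A) (f B) := fun A B hAB =>
        Set.disjoint_left.2 fun x hxA hxB => hxB.2 (mem_iUnion.2 ⟨⟨A, hAB⟩, hxA.1⟩)
      intro A B hne
      rcases trichotomous_of WellOrderingRel A B with h | h | h
      · exact key A B h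
      · exact absurd h hne
      · exact (key B A h).symm
    have hU : ⋃₀ 𝒮 = ⋃₀ range f := by
      rw [sUnion_range]
      refine subset_antisymm ?_ (iUnion_subset fun A => sdiff_subset.trans (subset_sUnion_of_mem A.2))
      rintro x ⟨A, hA, hx⟩
      obtain ⟨B, hB, hmin⟩ := (IsWellFounded.wf (r := (WellOrderingRel : 𝒮 → 𝒮 → Prop))).has_min
        {B : 𝒮 | x ∈ B.1} ⟨⟨A, hA⟩, hx⟩
      refine mem_iUnion.2 ⟨B, hB, fun hx' => ?_⟩
      obtain ⟨C, hC⟩ := mem_iUnion.1 hx'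
      exact hmin C.1 hC C.2
    rw [hU, hadd _ (mk_range_le.trans_lt hcard) ?_]
    · refine ENNReal.tsum_eq_zero.2 ?_
      rintro ⟨_, A, rfl⟩
      exact hmono _ _ sdiff_subset (hzero A.1 A.2)
    · rintro _ ⟨A, rfl⟩ _ ⟨B, rfl⟩ hne
      exact hdis fun h => hne (by rw [h])
  have hcompl : ∀ A, m A + m Aᶜ = 1 := fun A => by
    rw [← hbin A _ disjoint_compl_right, union_compl_self, huniv]
  let F : Filter κ.ord.ToType :=
    { sets := {A | m Aᶜ = 0}
      univ_sets := by simpa using hempty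
      sets_of_superset := fun hA hAB => hmono _ _ (compl_subset_compl.2 hAB) hA
      inter_sets := fun {A B} hA hB => by
        have := hnull {Aᶜ, Bᶜ} ((lt_aleph0_of_finite _).trans hκ) (by
          rintro C (rfl | rfl)
          exacts [hA, hB])
        rwa [sUnion_pair, ← compl_inter] at this }
  refine ⟨Ultrafilter.ofComplNotMemIff F fun A => ?_, fun 𝒮 hcard hA => ?_, fun a => ?_⟩
  · change ¬ m Aᶜᶜ = 0 ↔ m Aᶜ = 0
    rw [compl_compl]
    have := hcompl A
    rcases h01 A with h | h <;> rcases h01 Aᶜ with h' | h' <;> simp_all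
  · change m (⋂₀ 𝒮)ᶜ = 0
    rw [compl_sInter]
    refine hnull _ (mk_image_le.trans_lt hcard) ?_
    rintro _ ⟨A, hA', rfl⟩
    exact hA A hA'
  · change m {a}ᶜᶜ = 0
    rw [compl_compl, hpt]

variable {U : Ultrafilter κ.ord.ToType}

theorem compl_mem_of_mk_lt
    (hU : ∀ 𝒮 : Set (Set κ.ord.ToType), #𝒮 < κ → (∀ A ∈ 𝒮, A ∈ U) → ⋂₀ 𝒮 ∈ U)
    (hU' : ∀ a, {a}ᶜ ∈ U) {A : Set κ.ord.ToType} (hA : #A < κ) : Aᶜ ∈ U := by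
  have h := iInter_mem_of_complete (F := (U : Filter κ.ord.ToType)) hU
    (fun a : A => ({a.1}ᶜ : Set κ.ord.ToType)) hA fun a => hU' a
  refine U.mem_of_superset h fun x hx hxA => ?_
  exact mem_iInter.1 hx ⟨x, hxA⟩ rfl

theorem Ici_mem_of_complete
    (hU : ∀ 𝒮 : Set (Set κ.ord.ToType), #𝒮 < κ → (∀ A ∈ 𝒮, A ∈ U) → ⋂₀ 𝒮 ∈ U)
    (hU' : ∀ a, {a}ᶜ ∈ U) (i : κ.ord.ToType) : Ici i ∈ U := by
  rw [← compl_Iio]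
  exact compl_mem_of_mk_lt hU hU' (by simpa using mk_Iio_lt i (by simp))

theorem exists_forall_le_of_complete
    (hU : ∀ 𝒮 : Set (Set κ.ord.ToType), #𝒮 < κ → (∀ A ∈ 𝒮, A ∈ U) → ⋂₀ 𝒮 ∈ U)
    (hU' : ∀ a, {a}ᶜ ∈ U) {T : Type u} (hT : #T < κ) (f : T → κ.ord.ToType) :
    ∃ i, ∀ t, f t ≤ i := by
  obtain ⟨i, hi⟩ := U.nonempty_of_mem (iInter_mem_of_complete (F := (U : Filter κ.ord.ToType)) hU
    (fun t => Ici (f t)) hT fun t => Ici_mem_of_complete hU hU' _)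
  exact ⟨i, fun t => mem_iInter.1 hi t⟩

/-- Otherwise `κ` embeds in the power set of `μ`. Deciding for each `a` whether `a ∈ f i` for
`U`-almost all `i`, completeness yields a set in `U` on which the injection `f` is constant,
contradicting nonprincipality. -/
theorem two_power_lt_of_complete
    (hU : ∀ 𝒮 : Set (Set κ.ord.ToType), #𝒮 < κ → (∀ A ∈ 𝒮, A ∈ U) → ⋂₀ 𝒮 ∈ U)
    (hU' : ∀ a, {a}ᶜ ∈ U) {μ : Cardinal.{u}} (hμ : μ < κ) : 2 ^ μ < κ := by
  classical
  by_contra! h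
  have hle : #κ.ord.ToType ≤ #(Set μ.out) := by
    rw [mk_ord_toType, mk_set, mk_out]
    exact h
  obtain ⟨f⟩ := hle
  let S (a : μ.out) : Set κ.ord.ToType := {i | a ∈ f i}
  have hS := iInter_mem_of_complete (F := (U : Filter κ.ord.ToType)) hU
    (fun a : μ.out => if S a ∈ U then S a else (S a)ᶜ) (by rwa [mk_out]) fun a => by
      split_ifs with h
      · exact h
      · exact Ultrafilter.compl_mem_iff_notMem.2 h
  obtain ⟨i, hi⟩ := U.nonempty_of_mem hS
  obtain ⟨j, hj, hji⟩ := U.nonempty_of_mem (Filter.inter_mem hS (hU' i))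
  refine hji (f.injective ?_)
  ext a
  have h₁ := mem_iInter.1 hi a
  have h₂ := mem_iInter.1 hj a
  by_cases h : S a ∈ U
  · simp only [h, if_true] at h₁ h₂
    exact ⟨fun _ => h₁, fun _ => h₂⟩
  · simp only [h, if_false] at h₁ h₂
    exact ⟨fun h => absurd h h₂, fun h => absurd h h₁⟩

end Measurable

end AECLC

/-! ### Amalgamation over unions of bases, and the three cases. -/

namespace AECLC
namespace AEC

variable {L : FirstOrder.Language.{u, u}} (K : AEC L)

theorem isAmalgamationBase_of_equiv {F : Set Cardinal.{u}} {M M' : Type u} [L.Structure M]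
    [L.Structure M'] (e : M ≃[L] M') (h : K.IsAmalgamationBase F M) :
    K.IsAmalgamationBase F M' := by
  obtain ⟨hM, hc, ham⟩ := h
  refine ⟨K.mem_of_iso e hM, mk_congr e.toEquiv ▸ hc, ?_⟩
  intro M₁ M₂ _ _ f₁ f₂ h₁ h₂ hf₁ hf₂
  obtain ⟨N, _, g₁, g₂, hg₁, hg₂, hg⟩ := ham M₁ M₂ (f₁.comp e.toEmbedding)
    (f₂.comp e.toEmbedding) h₁ h₂ ((K.isEmb_comp_equiv _ _).2 hf₁) ((K.isEmb_comp_equiv _ _).2 hf₂)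
  exact ⟨N, inferInstance, g₁, g₂, hg₁, hg₂, fun m => by simpa using hg (e.symm m)⟩

/-- Approximations to an extension of a union. -/
theorem exists_approximation {M M' I : Type u} [L.Structure M] [L.Structure M']
    (hM' : K.Mem M') (f : M ↪[L] M') (Ms : I → L.Substructure M) (C : I → Set M')
    (ν : I → Cardinal.{u}) (hν : ∀ i, K.LS ≤ ν i) (hMs : ∀ i, #(Ms i) ≤ ν i)
    (hC : ∀ i, #(C i) ≤ ν i) :
    ∃ A : I → L.Substructure M', (∀ i, K.Strong (A i)) ∧ (∀ i, C i ⊆ A i) ∧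
      (∀ i, ∀ m ∈ Ms i, f m ∈ A i) ∧ ∀ i, #(Ms i) ≤ #(A i) ∧ #(A i) ≤ ν i := by
  have h : ∀ i, ∃ A : L.Substructure M', K.Strong A ∧ C i ∪ f '' (Ms i) ⊆ A ∧ #A ≤ ν i := fun i =>
    K.exists_strong_superset hM' (hν i) ((mk_union_le _ _).trans
      (add_le_of_le (K.aleph0_le_LS.trans (hν i)) (hC i) (mk_image_le.trans (hMs i))))
  choose A hA hCA hAc using h
  refine ⟨A, hA, fun i => subset_union_left.trans (hCA i),
    fun i m hm => hCA i (Or.inr ⟨m, hm, rfl⟩), fun i => ⟨?_, hAc i⟩⟩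
  exact (mk_image_eq f.injective).symm.le.trans
    (mk_le_mk_of_subset (subset_union_right.trans (hCA i)))

/-- Amalgamation over a structure approximated by amalgamation bases along a compact filter. -/
theorem exists_amalgam_of_bases {I : Type u} {F : Filter I} {θ : Cardinal.{u}}
    (hF : IsCompactFilter F K.LS θ) (hθ : K.LS ≤ θ) {M M₁ M₂ : Type u} [L.Structure M]
    [L.Structure M₁] [L.Structure M₂] (h₁ : #M₁ ≤ θ) (h₂ : #M₂ ≤ θ)
    {f₁ : M ↪[L] M₁} {f₂ : M ↪[L] M₂} (hf₁ : K.IsEmb f₁) (hf₂ : K.IsEmb f₂)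
    {Ms : I → L.Substructure M} (hMs : ∀ i, K.Strong (Ms i)) (hcov : ∀ m, {i | m ∈ Ms i} ∈ F)
    {ℱ : I → Set Cardinal.{u}} (hbase : ∀ i, K.IsAmalgamationBase (ℱ i) (Ms i))
    {ν : I → Cardinal.{u}} (hν : ∀ i, K.LS ≤ ν i) (hℱ : ∀ i c, c ∈ ℱ i → K.LS ≤ c)
    (hℱν : ∀ i c, #(Ms i) ≤ c → c ≤ ν i → c ∈ ℱ i) (hMν : ∀ i, #(Ms i) ≤ ν i)
    {C₁ : I → Set M₁} {C₂ : I → Set M₂} (hC₁ : ∀ i, #(C₁ i) ≤ ν i) (hC₂ : ∀ i, #(C₂ i) ≤ ν i)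
    (hcov₁ : ∀ m, {i | m ∈ C₁ i} ∈ F) (hcov₂ : ∀ m, {i | m ∈ C₂ i} ∈ F) :
    ∃ (N : Type u) (_ : L.Structure N) (k₁ : M₁ ↪[L] N) (k₂ : M₂ ↪[L] N),
      K.IsEmb k₁ ∧ K.IsEmb k₂ ∧ ∀ m : M, k₁ (f₁ m) = k₂ (f₂ m) := by
  have hM₁ := K.mem_target_of_isEmb hf₁
  have hM₂ := K.mem_target_of_isEmb hf₂
  obtain ⟨A₁, hA₁, hCA₁, hfA₁, hA₁c⟩ := K.exists_approximation hM₁ f₁ Ms C₁ ν hν hMν hC₁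
  obtain ⟨A₂, hA₂, hCA₂, hfA₂, hA₂c⟩ := K.exists_approximation hM₂ f₂ Ms C₂ ν hν hMν hC₂
  have hincl : ∀ {M' : Type u} [L.Structure M'] {f : M ↪[L] M'} (_ : K.IsEmb f) (i : I),
      K.IsEmb (f.comp (Ms i).subtype) := fun hf i =>
    K.isEmb_comp hf ((K.isEmb_subtype_iff _).2 (hMs i))
  choose P sP g₁ g₂ hg₁ hg₂ hag using fun i => (hbase i).2.2 (A₁ i) (A₂ i) _ _
    (hℱν i _ (hA₁c i).1 (hA₁c i).2) (hℱν i _ (hA₂c i).1 (hA₂c i).2)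
    (K.isEmb_codRestrict (hincl hf₁ i) (hA₁ i) fun m => hfA₁ i m m.2)
    (K.isEmb_codRestrict (hincl hf₂ i) (hA₂ i) fun m => hfA₂ i m m.2)
  have : ∀ i, Nonempty (P i) := fun i => by
    -- Every size in `ℱ i` is at least `LS(K)`, so `Ms i`, and hence `P i`, is nonempty.
    have hne : #(Ms i) ≠ 0 :=
      ((aleph0_pos.trans_le K.aleph0_le_LS).trans_le (hℱ i _ (hbase i).2.1)).ne'
    obtain ⟨m⟩ := mk_ne_zero_iff.1 hne
    exact ⟨g₁ i ⟨f₁ m, hfA₁ i m m.2⟩⟩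
  refine K.exists_amalgam hF hθ h₁ h₂ f₁ f₂ hM₁ hM₂ hA₁ hA₂
    (fun m => F.mem_of_superset (hcov₁ m) fun i hi => hCA₁ i hi)
    (fun m => F.mem_of_superset (hcov₂ m) fun i hi => hCA₂ i hi) hg₁ hg₂
    (fun m => F.mem_of_superset (hcov m) fun i hi => ⟨hfA₁ i m hi, hfA₂ i m hi, hag i ⟨m, hi⟩⟩)

theorem IsUnionOf.strong {M I : Type u} [L.Structure M] [PartialOrder I] [IsDirectedOrder I]
    [Nonempty I] {Ms : I → L.Substructure M} (h : K.IsUnionOf Ms) (i : I) : K.Strong (Ms i) :=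
  K.strong_of_directed_union_eq_univ h.1 h.2 i

theorem IsUnionOf.exists_mem {M I : Type u} [L.Structure M] [PartialOrder I]
    {Ms : I → L.Substructure M} (h : K.IsUnionOf Ms) (m : M) : ∃ i, m ∈ Ms i := by
  have : m ∈ ⋃ i, (Ms i : Set M) := h.2 ▸ mem_univ m
  simpa using this

theorem isAmalgamationBase_of_isWeaklyCompact {κ : Cardinal.{u}} (hκ : K.LS < κ)
    (hwc : IsWeaklyCompact κ) {M : Type u} [L.Structure M] {Ms : κ.ord.ToType → L.Substructure M}
    (hM : K.Mem M) (hcard : #M = κ) (hMs : K.IsUnionOf Ms)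
    (hb : ∀ i, K.IsAmalgamationBase (Set.Ico K.LS κ) (Ms i)) : K.IsAmalgamationBase {κ} M := by
  have : Nonempty κ.ord.ToType := Cardinal.nonempty_ord_toType hwc.1.ne_zero
  have hinf : ℵ₀ ≤ κ := hwc.1.aleph0_lt.le
  refine ⟨hM, hcard, ?_⟩
  intro M₁ M₂ _ _ f₁ f₂ h₁ h₂ hf₁ hf₂
  rw [mem_singleton_iff] at h₁ h₂
  obtain ⟨e₁⟩ : Nonempty (M₁ ≃ κ.ord.ToType) := Cardinal.eq.1 (by rw [h₁, mk_ord_toType])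
  obtain ⟨e₂⟩ : Nonempty (M₂ ≃ κ.ord.ToType) := Cardinal.eq.1 (by rw [h₂, mk_ord_toType])
  -- The size allowed at stage `i`: enough for the first elements of `M₁`, `M₂` up to `i` in an
  -- enumeration by `κ`, and still below `κ`.
  have hν : ∀ i, max (max #(Iic i) K.LS) #(Ms i) < κ := fun i => by
    refine max_lt (max_lt ?_ hκ) (hb i).2.1.2
    have h : #(Iio i) < κ := by simpa using mk_Iio_lt i (by simp)
    rw [← Iio_insert]
    exact mk_insert_le.trans_lt (add_lt_of_lt hinf h (one_lt_aleph0.trans_le hinf))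
  have hC : ∀ {M' : Type u} (e : M' ≃ κ.ord.ToType) (i : κ.ord.ToType),
      #(e ⁻¹' Iic i) ≤ max (max #(Iic i) K.LS) #(Ms i) := fun e i =>
    (mk_preimage_of_injective _ _ e.injective).trans ((le_max_left _ _).trans (le_max_left _ _))
  refine K.exists_amalgam_of_bases (hwc.isCompactFilter hκ) hκ.le h₁.le h₂.le hf₁ hf₂
    (IsUnionOf.strong K hMs) (fun m => ?_) hb (fun i => (le_max_right _ _).trans (le_max_left _ _))
    (fun i c hc => hc.1) (fun i c h h' => ⟨(hb i).2.1.1.trans h, h'.trans_lt (hν i)⟩)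
    (fun i => le_max_right _ _) (hC e₁) (hC e₂)
    (fun m => Filter.mem_of_superset (Filter.Ici_mem_atTop (e₁ m)) fun i hi => hi)
    (fun m => Filter.mem_of_superset (Filter.Ici_mem_atTop (e₂ m)) fun i hi => hi)
  obtain ⟨i, hi⟩ := IsUnionOf.exists_mem K hMs m
  exact Filter.mem_of_superset (Filter.Ici_mem_atTop i) fun j hj => (hMs.1 i j hj).1 hi

theorem isAmalgamationBase_of_isStronglyCompact {κ lam : Cardinal.{u}} (hκ : K.LS < κ)
    (hsc : IsStronglyCompactUpTo κ lam) {M : Type u} [L.Structure M]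
    {Ms : Pk κ lam → L.Substructure M} (hM : K.Mem M) (hcard : #M ≤ lam) (hMs : K.IsUnionOf Ms)
    (hb : ∀ x, K.IsAmalgamationBase (Set.Ico K.LS κ) (Ms x)) :
    K.IsAmalgamationBase (Set.Icc K.LS lam) M := by
  obtain ⟨-, hκlam, U, hU, hfine⟩ := hsc
  have hinf : ℵ₀ ≤ κ := K.aleph0_le_LS.trans hκ.le
  have : IsDirectedOrder (Pk κ lam) := ⟨fun x y => ⟨⟨x.1 ∪ y.1,
    (mk_union_le _ _).trans_lt (add_lt_of_lt hinf x.2 y.2)⟩, subset_union_left,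
    subset_union_right⟩⟩
  have : Nonempty (Pk κ lam) := ⟨⟨∅, by simpa using aleph0_pos.trans_le hinf⟩⟩
  -- Fineness puts the cone over each point in `U`; completeness gives the cone over each `x` of
  -- size below `κ`.
  have hIci : ∀ x, Ici x ∈ U := fun x => by
    have h := iInter_mem_of_complete (F := (U : Filter (Pk κ lam))) hU
      (fun a : x.1 => {y : Pk κ lam | a.1 ∈ y.1}) x.2 fun a => hfine a
    exact U.mem_of_superset h fun y hy a ha => mem_iInter.1 hy ⟨a, ha⟩
  refine ⟨hM, ⟨?_, hcard⟩, ?_⟩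
  · exact (hb (Classical.arbitrary _)).2.1.1.trans (mk_set_le _)
  intro M₁ M₂ _ _ f₁ f₂ h₁ h₂ hf₁ hf₂
  obtain ⟨e₁⟩ : Nonempty (M₁ ↪ lam.ord.ToType) := by
    rw [← Cardinal.le_def, mk_ord_toType]
    exact h₁.2
  obtain ⟨e₂⟩ : Nonempty (M₂ ↪ lam.ord.ToType) := by
    rw [← Cardinal.le_def, mk_ord_toType]
    exact h₂.2
  have hν : ∀ x : Pk κ lam, max (max #x.1 K.LS) #(Ms x) < κ := fun x =>
    max_lt (max_lt x.2 hκ) (hb x).2.1.2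
  have hC : ∀ {M' : Type u} (e : M' ↪ lam.ord.ToType) (x : Pk κ lam),
      #(e ⁻¹' x.1) ≤ max (max #x.1 K.LS) #(Ms x) := fun e i =>
    (mk_preimage_of_injective _ _ e.injective).trans ((le_max_left _ _).trans (le_max_left _ _))
  refine K.exists_amalgam_of_bases (isCompactFilter_of_complete U (θ := lam) hU hκ)
    (hκ.le.trans hκlam) h₁.2 h₂.2 hf₁ hf₂
    (IsUnionOf.strong K hMs) (fun m => ?_) hb (fun i => (le_max_right _ _).trans (le_max_left _ _))
    (fun i c hc => hc.1) (fun i c h h' => ⟨(hb i).2.1.1.trans h, h'.trans_lt (hν i)⟩)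
    (fun i => le_max_right _ _) (hC e₁) (hC e₂) (fun m => hfine (e₁ m)) (fun m => hfine (e₂ m))
  obtain ⟨i, hi⟩ := IsUnionOf.exists_mem K hMs m
  exact Filter.mem_of_superset (hIci i) fun j hj => (hMs.1 i j hj).1 hi

/-- The initial segment of length `ν` of `lam` has size at most `ν`. -/
theorem mk_initialSegment_le (lam ν : Cardinal.{u}) :
    #{x : lam.ord.ToType | (x.toOrd : Ordinal.{u}) < ν.ord} ≤ ν := by
  conv_rhs => rw [← mk_ord_toType ν]
  refine mk_le_of_injective (f := fun x : {x : lam.ord.ToType | (x.toOrd : Ordinal.{u}) < ν.ord} =>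
    Ordinal.ToType.mk ⟨x.1.toOrd, x.2⟩) fun x y h => ?_
  have h' := Ordinal.ToType.mk.injective h
  exact Subtype.ext (Ordinal.ToType.mk.symm.injective (Subtype.ext (Subtype.mk.inj h')))

/-- If the supremum is below `κ`, the chain reaches `M` at some stage and there is nothing to
amalgamate. Otherwise `#M` is the supremum and the ultrafilter argument applies. -/
theorem isAmalgamationBase_of_isMeasurable {κ : Cardinal.{u}} (hκ : K.LS < κ)
    (hme : IsMeasurable κ) {M : Type u} [L.Structure M] {Ms : κ.ord.ToType → L.Substructure M}
    {lam : κ.ord.ToType → Cardinal.{u}} (hM : K.Mem M) (hMs : K.IsUnionOf Ms)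
    (hb : ∀ i, K.IsAmalgamationBase {lam i} (Ms i)) : K.IsAmalgamationBase {⨆ i, lam i} M := by
  obtain ⟨U, hU, hU'⟩ := hme.exists_ultrafilter
  have hinf : ℵ₀ ≤ κ := hme.1.le
  have : Nonempty κ.ord.ToType := Cardinal.nonempty_ord_toType (aleph0_pos.trans_le hinf).ne'
  have hlam : ∀ i, #(Ms i) = lam i := fun i => (hb i).2.1
  have hmono : Monotone Ms := fun i j hij => (hMs.1 i j hij).1
  have hlmono : Monotone lam := fun i j hij => by
    rw [← hlam, ← hlam]
    exact mk_le_mk_of_subset (hmono hij)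
  have hbdd : BddAbove (range lam) := bddAbove_of_small
  have hle : ⨆ i, lam i ≤ #M := ciSup_le' fun i => (hlam i).symm.le.trans (mk_set_le _)
  have hsmall : ∀ C : Set M, #C < κ → ∃ i, C ⊆ Ms i := fun C hC => by
    choose a ha using fun m : C => IsUnionOf.exists_mem K hMs m
    obtain ⟨i, hi⟩ := exists_forall_le_of_complete hU hU' hC a
    exact ⟨i, fun m hm => hmono (hi ⟨m, hm⟩) (ha _)⟩
  rcases lt_or_ge (⨆ i, lam i) κ with hlt | hge
  · have hMκ : #M < κ := by
      by_contra! h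
      -- If `κ ≤ #M`, a subset of size the successor of the supremum would lie in a single `Ms i`,
      -- which is too small.
      have hsucc : Order.succ (⨆ i, lam i) < κ :=
        (Order.succ_le_of_lt (cantor _)).trans_lt (two_power_lt_of_complete hU hU' hlt)
      obtain ⟨C, hC⟩ := le_mk_iff_exists_set.1 (hsucc.le.trans h)
      obtain ⟨i, hi⟩ := hsmall C (hC ▸ hsucc)
      have h₁ : #C ≤ lam i := hlam i ▸ mk_le_mk_of_subset hi
      rw [hC] at h₁
      exact absurd (h₁.trans (le_ciSup hbdd i)) (not_le.2 (Order.lt_succ _))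
    obtain ⟨i, hi⟩ := hsmall Set.univ (by rwa [mk_univ])
    have htop : Ms i = ⊤ := top_le_iff.1 hi
    have hi' := hb i
    have hMi : #(Ms i) = #M := by
      rw [htop]
      exact mk_congr Substructure.topEquiv.toEquiv
    have hlami : lam i = ⨆ i, lam i :=
      le_antisymm (le_ciSup hbdd i) (hle.trans (by rw [← hMi, hlam]))
    rw [hlami, htop] at hi'
    exact K.isAmalgamationBase_of_equiv Substructure.topEquiv hi'
  have hcard : #M = ⨆ i, lam i := by
    refine le_antisymm ?_ hle
    rw [← mk_univ, ← hMs.2]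
    refine (mk_iUnion_le _).trans (mul_le_of_le (hinf.trans hge) ?_ ?_)
    · rwa [mk_ord_toType]
    · exact ciSup_le' fun i => (hlam i).le.trans (le_ciSup hbdd i)
  refine ⟨hM, hcard, ?_⟩
  intro M₁ M₂ _ _ f₁ f₂ h₁ h₂ hf₁ hf₂
  rw [mem_singleton_iff] at h₁ h₂
  -- A `lam i`-amalgamation base may have size below `LS(K)`; replacing `i` by `max i i₀` skips such
  -- stages.
  obtain ⟨i₀, hi₀⟩ := exists_lt_of_lt_ciSup (hκ.trans_le hge)
  obtain ⟨e₁⟩ : Nonempty (M₁ ≃ (⨆ i, lam i).ord.ToType) :=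
    Cardinal.eq.1 (by rw [h₁, mk_ord_toType])
  obtain ⟨e₂⟩ : Nonempty (M₂ ≃ (⨆ i, lam i).ord.ToType) :=
    Cardinal.eq.1 (by rw [h₂, mk_ord_toType])
  -- Initial segments of length `lam (max i i₀)` allow approximations of exactly the size that `Ms
  -- (max i i₀)` amalgamates, and they exhaust the supremum.
  let D (i : κ.ord.ToType) : Set (⨆ i, lam i).ord.ToType :=
    {x | (x.toOrd : Ordinal.{u}) < (lam (max i i₀)).ord}
  have hD : ∀ x, {i | x ∈ D i} ∈ U := fun x => by
    have hx : (x.toOrd : Ordinal.{u}).card < ⨆ i, lam i := lt_ord.1 x.toOrd.2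
    obtain ⟨i, hi⟩ := exists_lt_of_lt_ciSup hx
    exact U.mem_of_superset (Ici_mem_of_complete hU hU' i) fun j hj =>
      lt_ord.2 (hi.trans_le (hlmono (le_max_of_le_left hj)))
  have hC : ∀ {M' : Type u} (e : M' ≃ (⨆ i, lam i).ord.ToType) (i : κ.ord.ToType),
      #(e ⁻¹' D i) ≤ lam (max i i₀) := fun e i =>
    (mk_preimage_of_injective _ _ e.injective).trans (mk_initialSegment_le _ _)
  have hν : ∀ i, K.LS ≤ lam (max i i₀) := fun i => hi₀.le.trans (hlmono (le_max_right _ _))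
  refine K.exists_amalgam_of_bases (isCompactFilter_of_complete U (θ := ⨆ i, lam i) hU hκ)
    (hκ.le.trans hge) h₁.le h₂.le hf₁ hf₂ (Ms := fun i => Ms (max i i₀))
    (fun i => IsUnionOf.strong K hMs _) (fun m => ?_) (fun i => hb _) hν
    (fun i c hc => by rw [mem_singleton_iff.1 hc]; exact hν i)
    (fun i c h h' => le_antisymm h' ((hlam _).symm.le.trans h))
    (fun i => (hlam _).le) (hC e₁) (hC e₂) (fun m => hD (e₁ m)) (fun m => hD (e₂ m))
  obtain ⟨i, hi⟩ := IsUnionOf.exists_mem K hMs m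
  exact U.mem_of_superset (Ici_mem_of_complete hU hU' i) fun j hj =>
    hmono (le_max_of_le_left hj) hi

end AEC
end AECLC

theorem mainTheorem4 {L : FirstOrder.Language.{u, u}} (K : AECLC.AEC L) (κ : Cardinal.{u})
    (hκ : K.LS < κ) :
    -- weakly compact cardinals
    (AECLC.IsWeaklyCompact κ →
      ∀ (M : Type u) [L.Structure M] (Ms : κ.ord.ToType → L.Substructure M),
        K.Mem M → #M = κ → K.IsUnionOf Ms →
        (∀ i, K.IsAmalgamationBase (Set.Ico K.LS κ) (Ms i)) →
        K.IsAmalgamationBase {κ} M) ∧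
    -- measurable cardinals
    (AECLC.IsMeasurable κ →
      ∀ (M : Type u) [L.Structure M] (Ms : κ.ord.ToType → L.Substructure M)
        (lam : κ.ord.ToType → Cardinal.{u}),
        K.Mem M → K.IsUnionOf Ms →
        (∀ i, K.IsAmalgamationBase {lam i} (Ms i)) →
        K.IsAmalgamationBase {⨆ i, lam i} M) ∧
    -- partially strongly compact cardinals
    (∀ lam : Cardinal.{u}, AECLC.IsStronglyCompactUpTo κ lam →
      ∀ (M : Type u) [L.Structure M] (Ms : AECLC.Pk κ lam → L.Substructure M),
        K.Mem M → #M ≤ lam → K.IsUnionOf Ms →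
        (∀ x, K.IsAmalgamationBase (Set.Ico K.LS κ) (Ms x)) →
        K.IsAmalgamationBase (Set.Icc K.LS lam) M) :=
  ⟨fun hwc _ _ _ hM hcard hMs hb => K.isAmalgamationBase_of_isWeaklyCompact hκ hwc hM hcard hMs hb,
    fun hme _ _ _ _ hM hMs hb => K.isAmalgamationBase_of_isMeasurable hκ hme hM hMs hb,
    fun _ hsc _ _ _ hM hcard hMs hb =>
      K.isAmalgamationBase_of_isStronglyCompact hκ hsc hM hcard hMs hb⟩
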